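/- **Setting.** Let $M$ be a smooth $n$-manifold and $H$ a Hamilton function on $T^*M$: $H$ is smooth off the null section, continuous on $T^*M$, and $g^{ab}=\partial^2H/\partial p_a\partial p_b$ is non-degenerate and of constant signature off the null section. Let $(g_{ab})$ be the inverse of $(g^{ab})$. In natural coordinates $u=(x^i,p_a)$ put $\theta=dp_i\wedge dx^i$, $\{f,k\}=\frac{\partial f}{\partial p_i}\frac{\partial k}{\partial x^i}-\frac{\partial f}{\partial x^i}\frac{\partial k}{\partial p_i}$ and $$N_{ij}=\tfrac12\Big(\{g_{ij},H\}-\tfrac{\partial^2H}{\partial p_k\partial x^i}g_{jk}-\tfrac{\partial^2H}{\partial p_k\partial x^j}g_{ik}\Big).$$ Use the frame $e_\alpha=(e_i,e^b)$ and its dual coframe $e^\alpha=(e^i,e_b)$: $$e_i=\tfrac{\partial}{\partial x^i}+N_{ia}\tfrac{\partial}{\partial p_a},\quad e^b=\tfrac{\partial}{\partial p_b}-g^{bi}e_i,\qquad e^i=dx^i+g^{bi}e_b,\quad e_b=dp_b-N_{ib}dx^i,$$ with $[e_\alpha,e_\beta]=W^\gamma_{\alpha\beta}e_\gamma$. Let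 $\mathbf g=g_{ij}\,dx^i\otimes dx^j+g^{ab}\,e_a\otimes e_b$. Components of tensors are taken in this frame, and $\theta^{\alpha\beta}=\mathbf g^{\alpha\gamma}\mathbf g^{\beta\delta}\theta_{\gamma\delta}$, $\Lambda^{\alpha\beta}=\theta^{\alpha\beta}-i\,\mathbf g^{\alpha\beta}$. **Canonical $\phi$-connection.** It is $\widehat{\mathbf D}_{e_\alpha}e_\beta=\Gamma^\gamma_{\alpha\beta}e_\gamma$, given by $$\widehat{\mathbf D}_{e_k}e_j=L^i_{jk}e_i,\quad \widehat{\mathbf D}_{e_k}e^b=-L^b_{ck}e^c,\quad \widehat{\mathbf D}_{e^a}e_j=C_j^{ka}e_k,\quad \widehat{\mathbf D}_{e^a}e^b=-C_c^{ba}e^c,$$ where, with $\Omega_{ija}=e_i(N_{ja})-e_j(N_{ia})$, $A_{mij}=\Omega_{ijm}$ and $B^{mkj}=g^{mi}\big(g^{ka}e^j(N_{ia})-g^{ja}e^k(N_{ia})\big)$, $$L^k_{ij}=\tfrac12g^{km}\big(e_jg_{mi}+e_ig_{jm}-e_mg_{ij}\big)-\tfrac12g^{km}\big(A_{jim}+A_{ijm}+A_{mij}\big),$$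 $$C_i^{jk}=-\tfrac12g_{im}\big(e^jg^{mk}+e^kg^{jm}-e^mg^{jk}\big)-\tfrac12g_{im}\big(B^{jmk}+B^{kmj}+B^{mkj}\big).$$ Its torsion and curvature coefficients are taken with the signs of the structure equations $de^\tau+\Gamma^\tau_\gamma\wedge e^\gamma=-\frac12T^\tau_{\alpha\beta}e^\alpha\wedge e^\beta$ and $d\Gamma^\tau_\varphi+\Gamma^\tau_\sigma\wedge\Gamma^\sigma_\varphi=-\frac12R^\tau_{\ \varphi\alpha\beta}e^\alpha\wedge e^\beta$, with $\Gamma^\tau_\varphi=\Gamma^\tau_{\alpha\varphi}e^\alpha$. **Wick algebra.** Let $\mathcal W$ be the sheaf, on $T^*M$ minus the null section, of formal series $a=\sum a_{r,\mu}(u)z^\mu v^r$ with smooth complex coefficients. Here $z^\alpha$ are the fibre coordinates of the tangent spaces with respect to $e_\alpha$. Its product is $$a\circ b=\exp\Big(\tfrac{iv}2\Lambda^{\alpha\beta}\tfrac{\partial^2}{\partial z^\alpha\partial z'^\beta}\Big)a(z)b(z')\Big|_{z'=z}.$$ Extend $\circ$ to $\mathcal W\otimes\Lambda$ by the exterior product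 of forms. Let $\mathrm{ad}_{Wick}$ be the commutator of $\circ$ graded by form degree. On $\mathcal W\otimes\Lambda$ put $$\delta(a)=e^\alpha\wedge\tfrac{\partial a}{\partial z^\alpha},\qquad \widehat{\mathbf D}(a\otimes\lambda)=\Big(e_\alpha(a)-z^\beta\Gamma^\gamma_{\alpha\beta}\tfrac{\partial a}{\partial z^\gamma}\Big)\otimes(e^\alpha\wedge\lambda)+a\otimes d\lambda,$$ $$\mathcal T=\tfrac12z^\gamma\theta_{\gamma\tau}T^\tau_{\alpha\beta}\,e^\alpha\wedge e^\beta,\qquad \mathcal R=\tfrac14z^\gamma z^\varphi\theta_{\gamma\tau}R^\tau_{\ \varphi\alpha\beta}\,e^\alpha\wedge e^\beta.$$ **Theorem.** In every natural chart, and for every open subset $V$ of its domain minus the null section, $\delta$ and $\widehat{\mathbf D}$ map smooth sections of $\mathcal W\otimes\Lambda$ over $V$ to smooth sections. Moreover, $\mathrm{ad}_{Wick}(\mathcal T)$ and $\mathrm{ad}_{Wick}(\mathcal R)$ take values divisible by $v$, and $$[\widehat{\mathbf D},\delta]=\tfrac iv\,\mathrm{ad}_{Wick}(\mathcal T),\qquad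 \widehat{\mathbf D}^2=-\tfrac iv\,\mathrm{ad}_{Wick}(\mathcal R),$$ where $[\widehat{\mathbf D},\delta]=\widehat{\mathbf D}\delta+\delta\widehat{\mathbf D}$ is the commutator graded by form degree. -/

import Mathlib

open scoped Manifold ContDiff

noncomputable section

namespace FedosovHamilton

/-! ### Phase space in a natural chart -/

/-- Coordinates `(x, p)` of a natural chart of a cotangent bundle of an `n`-manifold. -/
abbrev Phase (n : ℕ) := EuclideanSpace ℝ (Fin n) × EuclideanSpace ℝ (Fin n)

/-- Indices `α = (i, a)`: `inl i` is a base index, `inr a` a fibre index. -/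
abbrev Idx (n : ℕ) := Fin n ⊕ Fin n

/-- The coordinate vectors `∂/∂x^i` and `∂/∂p_a`. -/
def coordVec {n : ℕ} : Idx n → Phase n
  | .inl i => (EuclideanSpace.single i 1, 0)
  | .inr a => (0, EuclideanSpace.single a 1)

/-- The partial derivative `∂f/∂x^i`. -/
def dX {n : ℕ} (i : Fin n) (f : Phase n → ℝ) (u : Phase n) : ℝ :=
  fderiv ℝ f u (coordVec (.inl i))

/-- The partial derivative `∂f/∂p_a`. -/
def dP {n : ℕ} (a : Fin n) (f : Phase n → ℝ) (u : Phase n) : ℝ :=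
  fderiv ℝ f u (coordVec (.inr a))

/-- The canonical symplectic form `θ = dp_i ∧ dx^i`. -/
def sympl {n : ℕ} (X Y : Phase n) : ℝ := ∑ i, (X.2 i * Y.1 i - Y.2 i * X.1 i)

/-- The Hamiltonian vector field `X_f = (∂f/∂p_i) ∂/∂x^i - (∂f/∂x^i) ∂/∂p_i`. -/
def hamVec {n : ℕ} (f : Phase n → ℝ) (u : Phase n) : Phase n :=
  ∑ i, (dP i f u • coordVec (.inl i) - dX i f u • coordVec (.inr i))

/-- The Poisson bracket `{f, k} = θ(X_f, X_k)`. -/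
def poisson {n : ℕ} (f k : Phase n → ℝ) (u : Phase n) : ℝ := sympl (hamVec f u) (hamVec k u)

/-- The fundamental tensor `g^{ab} = ∂²h/∂p_a∂p_b`. -/
def gUp {n : ℕ} (h : Phase n → ℝ) (u : Phase n) : Matrix (Fin n) (Fin n) ℝ :=
  Matrix.of fun a b => dP a (dP b h) u

/-- The inverse `g_{ab}` of the fundamental tensor. -/
def gLow {n : ℕ} (h : Phase n → ℝ) (u : Phase n) : Matrix (Fin n) (Fin n) ℝ := (gUp h u)⁻¹

/-! ### Hamilton spaces -/

/-- The expression of a function `H` on `T^*M` in the natural chart of `T^*M` induced by a chart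
`φ` of `M`: `(x, p) ↦ H(q, ∑ i, p_i dφ^i)` with `q = φ⁻¹(x)`. -/
def inChart {n : ℕ} {M : Type*} [TopologicalSpace M] [ChartedSpace (EuclideanSpace ℝ (Fin n)) M]
    (H : (q : M) → (TangentSpace (𝓡 n) q →L[ℝ] ℝ) → ℝ)
    (φ : OpenPartialHomeomorph M (EuclideanSpace ℝ (Fin n))) (u : Phase n) : ℝ :=
  H (φ.symm u.1)
    (∑ i, u.2 i • ((EuclideanSpace.proj i : EuclideanSpace ℝ (Fin n) →L[ℝ] ℝ) ∘L
      (mfderiv (𝓡 n) (𝓡 n) φ (φ.symm u.1) :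
        TangentSpace (𝓡 n) (φ.symm u.1) →L[ℝ] EuclideanSpace ℝ (Fin n))))

/-- The natural-chart domain in `T^*M` minus the null section. -/
def chartDomain {n : ℕ} {M : Type*} [TopologicalSpace M]
    (φ : OpenPartialHomeomorph M (EuclideanSpace ℝ (Fin n))) : Set (Phase n) :=
  φ.target ×ˢ {0}ᶜ

/-- A Hamilton space `(M, H)`: `H` is smooth off the null section of `T^*M`, continuous on `T^*M`,
and its fibre Hessian is non-degenerate and of constant signature off the null section. -/
structure HamiltonSpace (n : ℕ) (M : Type*) [TopologicalSpace M]
    [ChartedSpace (EuclideanSpace ℝ (Fin n)) M] where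
  /-- The fundamental Hamilton function. -/
  H : (q : M) → (TangentSpace (𝓡 n) q →L[ℝ] ℝ) → ℝ
  smooth : ∀ φ ∈ IsManifold.maximalAtlas (𝓡 n) ∞ M,
    ContDiffOn ℝ ∞ (inChart H φ) (chartDomain φ)
  continuous : ∀ φ ∈ IsManifold.maximalAtlas (𝓡 n) ∞ M,
    ContinuousOn (inChart H φ) (φ.target ×ˢ Set.univ)
  nondegenerate : ∀ φ ∈ IsManifold.maximalAtlas (𝓡 n) ∞ M, ∀ u ∈ chartDomain φ,
    (gUp (inChart H φ) u).det ≠ 0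
  constSignature : ∃ k : ℕ, ∀ φ ∈ IsManifold.maximalAtlas (𝓡 n) ∞ M, ∀ u ∈ chartDomain φ,
    sigPos (gUp (inChart H φ) u).toQuadraticForm' = k

/-! ### The canonical N-connection, frames, metric

From here on `h` is the expression of the Hamilton function in a natural chart. -/

/-- The canonical N-connection
`N_{ij} = ½ ({g_{ij}, h} - (∂²h/∂p_k∂x^i) g_{jk} - (∂²h/∂p_k∂x^j) g_{ik})`. -/
def nConn {n : ℕ} (h : Phase n → ℝ) (i j : Fin n) (u : Phase n) : ℝ :=
  (1 / 2) * (poisson (fun w => gLow h w i j) h u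
    - ∑ k, (dP k (dX i h) u * gLow h u j k + dP k (dX j h) u * gLow h u i k))

/-- The horizontal vectors `e_i = ∂/∂x^i + N_{ia} ∂/∂p_a`. -/
def hVec {n : ℕ} (h : Phase n → ℝ) (i : Fin n) (u : Phase n) : Phase n :=
  coordVec (.inl i) + ∑ a, nConn h i a u • coordVec (.inr a)

/-- The frame adapted to the canonical connection-pair:
`e_i = ∂/∂x^i + N_{ia} ∂/∂p_a` and `e^b = ∂/∂p_b - g^{bi} e_i`. -/
def frame {n : ℕ} (h : Phase n → ℝ) : Idx n → Phase n → Phase n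
  | .inl i, u => hVec h i u
  | .inr b, u => coordVec (.inr b) - ∑ i, gUp h u b i • hVec h i u

/-- The 1-forms `e_b = dp_b - N_{ib} dx^i`. -/
def vForm {n : ℕ} (h : Phase n → ℝ) (b : Fin n) (u X : Phase n) : ℝ :=
  X.2 b - ∑ i, nConn h i b u * X.1 i

/-- The dual coframe: `e^i = dx^i + g^{bi} e_b` and `e_b = dp_b - N_{ib} dx^i`. -/
def coframe {n : ℕ} (h : Phase n → ℝ) : Idx n → Phase n → Phase n → ℝ
  | .inl i, u, X => X.1 i + ∑ b, gUp h u b i * vForm h b u X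
  | .inr b, u, X => vForm h b u X

/-- The N-lift of the fundamental tensor: `g_{ij} dx^i ⊗ dx^j + g^{ab} e_a ⊗ e_b`, where
`e_a = dp_a - N_{ia} dx^i`. -/
def metric {n : ℕ} (h : Phase n → ℝ) (u X Y : Phase n) : ℝ :=
  (∑ i, ∑ j, gLow h u i j * X.1 i * Y.1 j) +
    ∑ a, ∑ b, gUp h u a b * vForm h a u X * vForm h b u Y

/-- The components `g^{αβ}` of the inverse metric in the adapted frame. -/
def metricInv {n : ℕ} (h : Phase n → ℝ) (u : Phase n) : Matrix (Idx n) (Idx n) ℝ :=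
  (Matrix.of fun α β => metric h u (frame h α u) (frame h β u))⁻¹

/-- The components `θ_{αβ}` of the symplectic form in the adapted frame. -/
def thetaLow {n : ℕ} (h : Phase n → ℝ) (u : Phase n) (α β : Idx n) : ℝ :=
  sympl (frame h α u) (frame h β u)

/-- The symplectic form with upper indices, `θ^{αβ} = g^{αγ} g^{βδ} θ_{γδ}`. -/
def thetaUp {n : ℕ} (h : Phase n → ℝ) (u : Phase n) (α β : Idx n) : ℝ :=
  ∑ γ, ∑ δ, metricInv h u α γ * metricInv h u β δ * thetaLow h u γ δ

/-- `Λ^{αβ} = θ^{αβ} - i g^{αβ}`. -/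
def lam {n : ℕ} (h : Phase n → ℝ) (u : Phase n) (α β : Idx n) : ℂ :=
  (thetaUp h u α β : ℂ) - Complex.I * (metricInv h u α β : ℂ)

/-! ### The canonical connection, its torsion and curvature -/

/-- The derivative `e_α(f)` along the adapted frame. -/
def eD {n : ℕ} (h : Phase n → ℝ) (α : Idx n) (f : Phase n → ℝ) (u : Phase n) : ℝ :=
  fderiv ℝ f u (frame h α u)

/-- The N-connection curvature
`Ω_{ija} = e_i(N_{ja}) - e_j(N_{ia})`, so that `[e_i, e_j] = Ω_{ija} ∂/∂p_a`. -/
def omegaN {n : ℕ} (h : Phase n → ℝ) (i j a : Fin n) (u : Phase n) : ℝ :=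
  eD h (.inl i) (nConn h j a) u - eD h (.inl j) (nConn h i a) u

/-- `A_{mij} = Ω_{ijm}`, the lowered horizontal part of `[e_i, e_j]`. -/
def anhA {n : ℕ} (h : Phase n → ℝ) (m i j : Fin n) (u : Phase n) : ℝ := omegaN h i j m u

/-- `B^{mkj} = g^{mi} (g^{ka} e^j(N_{ia}) - g^{ja} e^k(N_{ia}))`, the raised oblique part of
`[e^k, e^j]`. -/
def anhB {n : ℕ} (h : Phase n → ℝ) (m k j : Fin n) (u : Phase n) : ℝ :=
  ∑ i, ∑ a, gUp h u m i *
    (gUp h u k a * eD h (.inr j) (nConn h i a) u - gUp h u j a * eD h (.inr k) (nConn h i a) u)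

/-- The coefficients `L^k_{ij}`, where `D_{e_j} e_i = L^k_{ij} e_k`. -/
def coefL {n : ℕ} (h : Phase n → ℝ) (k i j : Fin n) (u : Phase n) : ℝ :=
  (1 / 2) * (∑ m, gUp h u k m *
    (eD h (.inl j) (fun w => gLow h w m i) u + eD h (.inl i) (fun w => gLow h w j m) u
      - eD h (.inl m) (fun w => gLow h w i j) u))
  - (1 / 2) * (∑ m, gUp h u k m * (anhA h j i m u + anhA h i j m u + anhA h m i j u))

/-- The coefficients `C_i^{jk}`, where `D_{e^k} e^j = -C_i^{jk} e^i`. -/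
def coefC {n : ℕ} (h : Phase n → ℝ) (i j k : Fin n) (u : Phase n) : ℝ :=
  -(1 / 2) * (∑ m, gLow h u i m *
    (eD h (.inr j) (fun w => gUp h w m k) u + eD h (.inr k) (fun w => gUp h w j m) u
      - eD h (.inr m) (fun w => gUp h w j k) u))
  - (1 / 2) * (∑ m, gLow h u i m * (anhB h j m k u + anhB h k m j u + anhB h m k j u))

/-- The coefficients `Γ^γ_{αβ}` (here `gam h α β γ`) of the canonical connection in the adapted
frame, `D_{e_α} e_β = Γ^γ_{αβ} e_γ`. It preserves the splitting and
`D_{e_k} e_j = L^i_{jk} e_i`, `D_{e_k} e^b = -L^b_{ck} e^c`, `D_{e^a} e_j = C_j^{ka} e_k`,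
`D_{e^a} e^b = -C_c^{ba} e^c`. -/
def gam {n : ℕ} (h : Phase n → ℝ) : Idx n → Idx n → Idx n → Phase n → ℝ
  | .inl k, .inl j, .inl i, u => coefL h i j k u
  | .inl k, .inr b, .inr c, u => -coefL h b c k u
  | .inr a, .inl j, .inl k, u => coefC h j k a u
  | .inr a, .inr b, .inr c, u => -coefC h c b a u
  | _, .inl _, .inr _, _ => 0
  | _, .inr _, .inl _, _ => 0

/-- The anholonomy coefficients (here `anh h α β γ`): `[e_α, e_β] = W^γ_{αβ} e_γ`. -/
def anh {n : ℕ} (h : Phase n → ℝ) (α β γ : Idx n) (u : Phase n) : ℝ :=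
  coframe h γ u (VectorField.lieBracket ℝ (frame h α) (frame h β) u)

/-- The torsion coefficients `T^τ_{αβ}`, with the sign convention
`de^τ + Γ^τ_{αγ} e^α ∧ e^γ = - ½ T^τ_{αβ} e^α ∧ e^β` of the structure equations. -/
def tors {n : ℕ} (h : Phase n → ℝ) (τ α β : Idx n) (u : Phase n) : ℝ :=
  gam h β α τ u - gam h α β τ u + anh h α β τ u

/-- The curvature coefficients `R^τ_{φαβ}`, with the sign convention
`dΓ^τ_φ + Γ^τ_σ ∧ Γ^σ_φ = - ½ R^τ_{φαβ} e^α ∧ e^β`, `Γ^τ_φ = Γ^τ_{αφ} e^α`, of the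
structure equations. -/
def curv {n : ℕ} (h : Phase n → ℝ) (τ φ α β : Idx n) (u : Phase n) : ℝ :=
  eD h β (gam h α φ τ) u - eD h α (gam h β φ τ) u
    + ∑ σ, (gam h α φ σ u * gam h β σ τ u - gam h β φ σ u * gam h α σ τ u
      + anh h α β σ u * gam h σ φ τ u)

/-! ### The Wick-algebra-valued forms -/

/-- Complex exterior forms at a point, generated by the coordinate differentials `du^α`. -/
abbrev Form (n : ℕ) := ExteriorAlgebra ℂ (Idx n → ℂ)

/-- The basis of `Form n` made of the products of coordinate differentials. -/
def formBasis (n : ℕ) : Module.Basis (Finset (Fin (n + n))) ℂ (Form n) :=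
  ((Pi.basisFun ℂ (Idx n)).reindex finSumFinEquiv).ExteriorAlgebra

/-- Formal power series in the fibre variables `z^α` with values in forms. The `z^α` are the
linear fibre coordinates of the tangent spaces with respect to the adapted frame. -/
abbrev ZSeries (n : ℕ) := MvPowerSeries (Idx n) (Form n)

/-- A fibre of the bundle of Wick-algebra-valued forms: formal series `∑ a_{r,μ} z^μ v^r` with
values in forms (`v` and `z^α` are central). -/
abbrev WFiber (n : ℕ) := PowerSeries (ZSeries n)

/-- The coefficient of `v^r z^μ`. -/
def wCoeff {n : ℕ} (r : ℕ) (μ : Idx n →₀ ℕ) (a : WFiber n) : Form n :=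
  MvPowerSeries.coeff μ (PowerSeries.coeff r a)

/-- The element with given coefficients. -/
def wMk {n : ℕ} (c : ℕ → (Idx n →₀ ℕ) → Form n) : WFiber n :=
  PowerSeries.mk fun r => fun μ => c r μ

/-- A section `a` over `V` is smooth: all its component functions are smooth on `V`. -/
def IsSmoothSection {n : ℕ} (V : Set (Phase n)) (a : Phase n → WFiber n) : Prop :=
  ∀ r μ S, ContDiffOn ℝ ∞ (fun u => (formBasis n).repr (wCoeff r μ (a u)) S) V

/-- A scalar form, seen in the fibre (constant in `z` and `v`). -/
def ofForm {n : ℕ} (η : Form n) : WFiber n := PowerSeries.C (MvPowerSeries.C η)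

/-- The fibre coordinate `z^α`. -/
def zVar {n : ℕ} (α : Idx n) : WFiber n := PowerSeries.C (MvPowerSeries.X α)

/-- The coframe 1-form `e^α` at `u`, seen in the fibre. -/
def coframeForm {n : ℕ} (h : Phase n → ℝ) (α : Idx n) (u : Phase n) : WFiber n :=
  ofForm (ExteriorAlgebra.ι ℂ fun β => (coframe h α u (coordVec β) : ℂ))

/-- The derivative `∂/∂z^α` of a formal power series in `z`. -/
def zDerivSeries {n : ℕ} (α : Idx n) (f : ZSeries n) : ZSeries n := fun μ =>
  (μ α + 1) • MvPowerSeries.coeff (μ + Finsupp.single α 1) f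

/-- The derivative `∂/∂z^α`, i.e. along the vector `e_α` in the fibre. -/
def zDeriv {n : ℕ} (α : Idx n) (a : WFiber n) : WFiber n :=
  PowerSeries.mk fun r => zDerivSeries α (PowerSeries.coeff r a)

/-- The derivative of a section along a vector `X` at `u`, acting on all component functions with
respect to the monomials in `v`, `z^α` and the coordinate differentials. -/
def dirDeriv {n : ℕ} (a : Phase n → WFiber n) (u X : Phase n) : WFiber n :=
  wMk fun r μ => ∑ S, (fderiv ℝ (fun w => (formBasis n).repr (wCoeff r μ (a w)) S) u X) •
    formBasis n S

/-- The `k`-th power of `Λ^{αβ} ∂/∂z^α ⊗ ∂/∂z^β` applied to `f ⊗ g`, followed by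
multiplication. -/
def biDiff {n : ℕ} (Lam : Idx n → Idx n → ℂ) : ℕ → ZSeries n → ZSeries n → ZSeries n
  | 0, f, g => f * g
  | k + 1, f, g => ∑ α, ∑ β, Lam α β • biDiff Lam k (zDerivSeries α f) (zDerivSeries β g)

/-- The Wick product
`a ∘ b = exp((i v / 2) Λ^{αβ} ∂²/∂z^α∂z'^β) a(z) b(z') |_{z = z'}`, extended to forms by the
exterior product. The coefficient of `v^r` collects the terms `v^k v^p v^q`, `k + p + q = r`. -/
def wick {n : ℕ} (Lam : Idx n → Idx n → ℂ) (a b : WFiber n) : WFiber n :=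
  PowerSeries.mk fun r => ∑ k ∈ Finset.range (r + 1), ∑ s ∈ Finset.HasAntidiagonal.antidiagonal (r - k),
    ((Complex.I / 2) ^ k / (k.factorial : ℂ)) •
      biDiff Lam k (PowerSeries.coeff s.1 a) (PowerSeries.coeff s.2 b)

/-- The component of form degree `q`. -/
def degPart {n : ℕ} (q : ℕ) (a : WFiber n) : WFiber n :=
  wMk fun r μ => GradedRing.proj (fun i : ℕ => ⋀[ℂ]^i (Idx n → ℂ)) q (wCoeff r μ a)

/-- `ad_Wick(a)`: the commutator with respect to the Wick product graded by the form degree,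
`ad_Wick(a) b = a ∘ b - (-1)^{pq} b ∘ a` for `a`, `b` of form degrees `p`, `q`. -/
def adWick {n : ℕ} (Lam : Idx n → Idx n → ℂ) (a b : WFiber n) : WFiber n :=
  ∑ p ∈ Finset.range (2 * n + 1), ∑ q ∈ Finset.range (2 * n + 1),
    (wick Lam (degPart p a) (degPart q b) -
      (-1 : ℂ) ^ (p * q) • wick Lam (degPart q b) (degPart p a))

/-- Division by `v` of a series without term of order zero in `v`. -/
def divV {n : ℕ} (a : WFiber n) : WFiber n :=
  PowerSeries.mk fun r => PowerSeries.coeff (r + 1) a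

/-! ### The operators and the theorem's forms -/

/-- The operator `δ(a) = e^α ∧ ∂a/∂z^α`. -/
def delta {n : ℕ} (h : Phase n → ℝ) (a : Phase n → WFiber n) (u : Phase n) : WFiber n :=
  ∑ α, coframeForm h α u * zDeriv α (a u)

/-- The extended operator
`D(a ⊗ λ) = (e_α(a) - z^β Γ^γ_{αβ} ∂a/∂z^γ) ⊗ (e^α ∧ λ) + a ⊗ dλ`. Since `e_α` acts here on the
components with respect to the closed forms `du^S`, the term `e^α ∧ e_α(·)` is the exterior
derivative with `z` fixed; it produces `e_α(a) ⊗ (e^α ∧ λ) + a ⊗ dλ`. -/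
def extD {n : ℕ} (h : Phase n → ℝ) (a : Phase n → WFiber n) (u : Phase n) : WFiber n :=
  ∑ α, coframeForm h α u * (dirDeriv a u (frame h α u) -
    ∑ β, ∑ γ, (gam h α β γ u : ℂ) • (zVar β * zDeriv γ (a u)))

/-- The commutator `A B - (-1)^{pq} B A` of endomorphisms of form degrees `p` and `q`. -/
def gradedCommutator {n : ℕ} (p q : ℕ) (A B : (Phase n → WFiber n) → Phase n → WFiber n)
    (a : Phase n → WFiber n) (u : Phase n) : WFiber n :=
  A (B a) u - (-1 : ℂ) ^ (p * q) • B (A a) u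

/-- The torsion form `𝒯 = ½ z^γ θ_{γτ} T^τ_{αβ} e^α ∧ e^β`. -/
def torsionForm {n : ℕ} (h : Phase n → ℝ) (u : Phase n) : WFiber n :=
  ∑ γ, ∑ τ, ∑ α, ∑ β, ((1 / 2 * thetaLow h u γ τ * tors h τ α β u : ℝ) : ℂ) •
    (zVar γ * (coframeForm h α u * coframeForm h β u))

/-- The curvature form `ℛ = ¼ z^γ z^φ θ_{γτ} R^τ_{φαβ} e^α ∧ e^β`. -/
def curvatureForm {n : ℕ} (h : Phase n → ℝ) (u : Phase n) : WFiber n :=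
  ∑ γ, ∑ φ, ∑ τ, ∑ α, ∑ β, ((1 / 4 * thetaLow h u γ τ * curv h τ φ α β u : ℝ) : ℂ) •
    (zVar γ * zVar φ * (coframeForm h α u * coframeForm h β u))

end FedosovHamilton

end

/-! Each identity holds because both of its sides equal the same explicit fibrewise derivation.

Geometric side. Over the closed differentials `du^A`, the operator `extD` becomes `du^A ∧ (∂_A - z
M_A ∂_z)` and `delta` becomes `du^A ∧ (c_A · ∂_z)`, with `M_A` and `c_A` the coordinate components
of connection and coframe. Since the `du^A` anticommute, only the part antisymmetric in two indices
survives. Second derivatives of the section cancel by Schwarz, its first derivatives cancel in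
pairs, and the Weyl algebra relations `[zM∂, zN∂] = z(MN - NM)∂` and `[c·∂, zM∂] = (cM)·∂` leave the
two structure equations. Returning to the adapted frame, the square is `½ e^α ∧ e^β R^τ_{φαβ} z^φ
∂/∂z^τ` (`extD_extD`) and the graded commutator is `-½ e^α ∧ e^β T^τ_{αβ} ∂/∂z^τ` (`extD_delta`).

Algebraic side. The torsion and curvature elements are polynomials in `z` of degree at most two
whose coefficients are 2-forms, and 2-forms are central. Swapping the factors of the Wick product
therefore only transposes `Λ`. In the commutator the term of order 0 in `Λ` cancels, the term of
order 1 gives `v` times the bracket with `iθ^{αβ}`, and terms of order 3 or more vanish by degree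
(`wick_sub_wick`, `adWick_eq`). Contracting `θ^{αβ}` with the `θ_{ατ}` built into the elements
returns `T` and `R` (`bracketOp_torsionForm`, `bracketOp_curvatureForm`).

The delicate point is order 2 for the curvature. Its contribution reduces to the mixed terms `θ ⊗ g
+ g ⊗ θ` (`second_order_symm`), which vanish when `R` is infinitesimally symplectic and
infinitesimally orthogonal. The first property holds because the vertical block of the connection is
dual to the horizontal one, in a frame where `θ` is constant (`thetaLow_curv_symm`). The second
follows from compatibility of the connection with the fundamental tensor (`eDMat_gUp`,
`curvMat_mul_gUp`, `curv_metricInv_skew`). No vanishing of torsion enters. -/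

noncomputable section

namespace FedosovHamilton

variable {n : ℕ}

/-! ### Operators on a fibre -/

lemma wCoeff_ext {x y : WFiber n} (hxy : ∀ r μ, wCoeff r μ x = wCoeff r μ y) : x = y :=
  PowerSeries.ext fun r => MvPowerSeries.ext fun μ => hxy r μ

/-- The component function of `v^r z^μ du^S`. -/
def coordFun (r : ℕ) (μ : Idx n →₀ ℕ) (S : Finset (Fin (n + n))) : WFiber n →ₗ[ℂ] ℂ where
  toFun x := (formBasis n).repr (wCoeff r μ x) S
  map_add' x y := by simp [wCoeff]
  map_smul' c x := by
    have : wCoeff r μ (c • x) = c • wCoeff r μ x := rfl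
    simp [this]

lemma coordFun_apply (r : ℕ) (μ : Idx n →₀ ℕ) (S : Finset (Fin (n + n))) (x : WFiber n) :
    coordFun r μ S x = (formBasis n).repr (wCoeff r μ x) S := rfl

lemma coordFun_ext {x y : WFiber n} (hxy : ∀ r μ S, coordFun r μ S x = coordFun r μ S y) :
    x = y :=
  wCoeff_ext fun r μ => (formBasis n).repr.injective (Finsupp.ext fun S => hxy r μ S)

/-- Multiplication by `z^β`. -/
def zM (β : Idx n) : Module.End ℂ (WFiber n) := LinearMap.mulLeft ℂ (zVar β)

/-- Exterior multiplication by a form. -/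
def formMul (η : Form n) : Module.End ℂ (WFiber n) := LinearMap.mulLeft ℂ (ofForm η)

lemma wCoeff_mk (c : ℕ → (Idx n →₀ ℕ) → Form n) (r : ℕ) (μ : Idx n →₀ ℕ) :
    wCoeff r μ (wMk c) = c r μ :=
  congrArg (MvPowerSeries.coeff μ) (PowerSeries.coeff_mk r fun r => (fun μ => c r μ : ZSeries n))

lemma wCoeff_add (r : ℕ) (μ : Idx n →₀ ℕ) (x y : WFiber n) :
    wCoeff r μ (x + y) = wCoeff r μ x + wCoeff r μ y := rfl

lemma wCoeff_smul (r : ℕ) (μ : Idx n →₀ ℕ) (c : ℂ) (x : WFiber n) :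
    wCoeff r μ (c • x) = c • wCoeff r μ x := rfl

lemma wCoeff_zDeriv (r : ℕ) (μ : Idx n →₀ ℕ) (α : Idx n) (x : WFiber n) :
    wCoeff r μ (zDeriv α x) = (μ α + 1) • wCoeff r (μ + Finsupp.single α 1) x :=
  congrArg (MvPowerSeries.coeff μ)
    (PowerSeries.coeff_mk r fun r => zDerivSeries α (PowerSeries.coeff r x))

/-- The derivative `∂/∂z^α` as a linear operator. -/
def zD (α : Idx n) : Module.End ℂ (WFiber n) where
  toFun := zDeriv α
  map_add' x y := wCoeff_ext fun r μ => by
    simp only [wCoeff_add, wCoeff_zDeriv, smul_add]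
  map_smul' c x := wCoeff_ext fun r μ => by
    simp only [wCoeff_smul, wCoeff_zDeriv, RingHom.id_apply, smul_comm c]

/-- Exterior multiplication by the coordinate differential `du^A`. -/
def eps (A : Idx n) : Module.End ℂ (WFiber n) :=
  formMul (ExteriorAlgebra.ι ℂ (Pi.single A 1))

lemma zM_apply (β : Idx n) (x : WFiber n) : zM β x = zVar β * x := rfl
lemma zD_apply (β : Idx n) (x : WFiber n) : zD β x = zDeriv β x := rfl
lemma formMul_apply (η : Form n) (x : WFiber n) : formMul η x = ofForm η * x := rfl

lemma wCoeff_zD (r : ℕ) (μ : Idx n →₀ ℕ) (α : Idx n) (x : WFiber n) :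
    wCoeff r μ (zD α x) = (μ α + 1) • wCoeff r (μ + Finsupp.single α 1) x :=
  wCoeff_zDeriv r μ α x

lemma wCoeff_zM (r : ℕ) (μ : Idx n →₀ ℕ) (β : Idx n) (x : WFiber n) :
    wCoeff r μ (zM β x) =
      if Finsupp.single β 1 ≤ μ then wCoeff r (μ - Finsupp.single β 1) x else 0 := by
  classical
  simp only [zM_apply, wCoeff, zVar, PowerSeries.coeff_C_mul, MvPowerSeries.X,
    MvPowerSeries.coeff_monomial_mul, one_mul]

lemma wCoeff_formMul (r : ℕ) (μ : Idx n →₀ ℕ) (η : Form n) (x : WFiber n) :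
    wCoeff r μ (formMul η x) = η * wCoeff r μ x := by
  simp only [formMul_apply, wCoeff, ofForm, PowerSeries.coeff_C_mul, MvPowerSeries.coeff_C_mul]

lemma ofForm_mul (η ζ : Form n) : ofForm (η * ζ) = ofForm η * ofForm ζ := by
  simp [ofForm]

lemma formMul_mul (η ζ : Form n) : formMul η * formMul ζ = formMul (η * ζ) := by
  ext1 x
  simp [formMul_apply, ofForm_mul, mul_assoc]

lemma formMul_add (η ζ : Form n) : formMul (η + ζ) = formMul η + formMul ζ := by
  ext1 x
  simp [formMul_apply, ofForm, add_mul]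

lemma formMul_smul (c : ℂ) (η : Form n) : formMul (c • η) = c • formMul η := by
  ext1 x
  exact wCoeff_ext fun r μ => by
    change wCoeff r μ (formMul (c • η) x) = c • wCoeff r μ (formMul η x)
    simp [wCoeff_formMul]

lemma formMul_zero : formMul (0 : Form n) = 0 := by
  ext1 x
  simp [formMul_apply, ofForm]

/-- Exterior multiplication by a form depends linearly on the form. -/
def formMulHom : Form n →ₗ[ℂ] Module.End ℂ (WFiber n) where
  toFun := formMul
  map_add' := formMul_add
  map_smul' := formMul_smul

lemma zD_zD_comm (α β : Idx n) : zD α * zD β = (zD β * zD α : Module.End ℂ (WFiber n)) := by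
  ext1 x
  refine wCoeff_ext fun r μ => ?_
  simp only [Module.End.mul_apply, wCoeff_zD, smul_smul, add_right_comm μ]
  congr 1
  by_cases hαβ : α = β
  · subst hαβ; rfl
  · simp [hαβ, Ne.symm hαβ, mul_comm]

lemma zM_zM_comm (α β : Idx n) : zM α * zM β = (zM β * zM α : Module.End ℂ (WFiber n)) := by
  ext1 x
  have : (zVar α : WFiber n) * zVar β = zVar β * zVar α := by
    simp only [zVar, ← map_mul]
    rw [(MvPowerSeries.commute_X (MvPowerSeries.X α) β).eq]
  simp only [Module.End.mul_apply, zM_apply, ← mul_assoc, this]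

/-- The canonical commutation relation. Together with commutativity of the `zD` and of the `zM`, it
is the only input for the operator commutators of the Weyl algebra below. -/
lemma zD_zM (γ β : Idx n) :
    zD γ * zM β = (zM β * zD γ + if γ = β then 1 else 0 : Module.End ℂ (WFiber n)) := by
  classical
  ext1 x
  refine wCoeff_ext fun r μ => ?_
  rw [LinearMap.add_apply, wCoeff_add]
  simp only [Module.End.mul_apply, wCoeff_zD, wCoeff_zM]
  by_cases hγβ : γ = β
  · subst hγβ
    simp only [le_add_iff_nonneg_left, zero_le, if_true, add_tsub_cancel_right,
      Module.End.one_apply]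
    by_cases hμ : Finsupp.single γ 1 ≤ μ
    · have h1 : 1 ≤ μ γ := by simpa using hμ γ
      rw [if_pos hμ, tsub_add_cancel_of_le hμ, Finsupp.tsub_apply, Finsupp.single_eq_same,
        Nat.sub_add_cancel h1, add_smul, one_smul]
    · have h1 : μ γ = 0 := by
        rw [Finsupp.single_le_iff] at hμ
        omega
      simp [hμ, h1]
  · have h2 : (Finsupp.single β 1 ≤ μ + Finsupp.single γ 1) ↔ Finsupp.single β 1 ≤ μ := by
      simp [Finsupp.single_le_iff, hγβ]
    rw [if_neg hγβ, LinearMap.zero_apply]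
    simp only [h2]
    by_cases hμ : Finsupp.single β 1 ≤ μ
    · simp only [hμ, if_true]
      have h3 : μ + Finsupp.single γ 1 - Finsupp.single β 1
          = μ - Finsupp.single β 1 + Finsupp.single γ 1 :=
        tsub_add_eq_add_tsub hμ |>.symm
      rw [h3]
      simp [Ne.symm hγβ, wCoeff]
    · simp [hμ, wCoeff]

lemma formMul_zM_comm (η : Form n) (β : Idx n) :
    zM β * formMul η = (formMul η * zM β : Module.End ℂ (WFiber n)) := by
  ext1 x
  refine wCoeff_ext fun r μ => ?_
  simp only [Module.End.mul_apply, wCoeff_formMul, wCoeff_zM]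
  split_ifs <;> simp

lemma formMul_zD_comm (η : Form n) (β : Idx n) :
    zD β * formMul η = (formMul η * zD β : Module.End ℂ (WFiber n)) := by
  ext1 x
  refine wCoeff_ext fun r μ => ?_
  simp only [Module.End.mul_apply, wCoeff_formMul, wCoeff_zD, mul_smul_comm]

lemma eps_eps (A B : Idx n) : eps A * eps B = (-(eps B * eps A) : Module.End ℂ (WFiber n)) := by
  have h1 := ExteriorAlgebra.ι_add_mul_swap (R := ℂ) (Pi.single A 1 : Idx n → ℂ) (Pi.single B 1)
  rw [eps, eps, formMul_mul, formMul_mul, eq_neg_iff_add_eq_zero, ← formMul_add, h1, formMul_zero]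

/-- A double sum over products of differentials sees only the antisymmetric part. -/
lemma sum_eps_eps (F : Idx n → Idx n → WFiber n) :
    ∑ A, ∑ B, eps A (eps B (F A B)) =
      (1 / 2 : ℂ) • ∑ A, ∑ B, eps A (eps B (F A B - F B A)) := by
  have h1 : ∑ A, ∑ B, eps A (eps B (F B A)) = -∑ A, ∑ B, eps A (eps B (F A B)) := by
    rw [Finset.sum_comm, ← Finset.sum_neg_distrib]
    refine Finset.sum_congr rfl fun A _ => ?_
    rw [← Finset.sum_neg_distrib]
    refine Finset.sum_congr rfl fun B _ => ?_
    have := congrArg (fun T => T (F A B)) (eps_eps B A)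
    simpa using this
  simp only [map_sub, Finset.sum_sub_distrib, h1, sub_neg_eq_add]
  rw [← two_smul ℂ, smul_smul]
  norm_num

/-! ### Calculus of sections -/

/-- An operator is row-finite if the components of its values are finite linear combinations of
components of the argument. -/
def RowFinite (T : Module.End ℂ (WFiber n)) : Prop :=
  ∀ r μ S, coordFun r μ S ∘ₗ T ∈ Submodule.span ℂ
    (Set.range fun p : ℕ × (Idx n →₀ ℕ) × Finset (Fin (n + n)) => coordFun p.1 p.2.1 p.2.2)

lemma coordFun_mem_span (r : ℕ) (μ : Idx n →₀ ℕ) (S : Finset (Fin (n + n))) :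
    coordFun r μ S ∈ Submodule.span ℂ
      (Set.range fun p : ℕ × (Idx n →₀ ℕ) × Finset (Fin (n + n)) => coordFun p.1 p.2.1 p.2.2) :=
  Submodule.subset_span ⟨(r, μ, S), rfl⟩

lemma rowFinite_zD (α : Idx n) : RowFinite (n := n) (zD α) := fun r μ S => by
  have : coordFun r μ S ∘ₗ zD α = (μ α + 1) • coordFun r (μ + Finsupp.single α 1) S := by
    ext x
    simp only [LinearMap.comp_apply, coordFun_apply, wCoeff_zD, LinearMap.smul_apply, map_nsmul,
      Finsupp.smul_apply]
  rw [this]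
  exact Submodule.smul_of_tower_mem _ _ (coordFun_mem_span _ _ _)

lemma rowFinite_zM (β : Idx n) : RowFinite (n := n) (zM β) := fun r μ S => by
  classical
  have : coordFun r μ S ∘ₗ zM β =
      if Finsupp.single β 1 ≤ μ then coordFun r (μ - Finsupp.single β 1) S else 0 := by
    ext x
    simp only [LinearMap.comp_apply, coordFun_apply, wCoeff_zM]
    split_ifs <;> simp [coordFun_apply]
  rw [this]
  split_ifs
  · exact coordFun_mem_span _ _ _
  · exact zero_mem _

lemma rowFinite_formMul (η : Form n) : RowFinite (formMul η) := fun r μ S => by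
  have : coordFun r μ S ∘ₗ formMul η =
      ∑ S', (formBasis n).repr (η * formBasis n S') S • coordFun r μ S' := by
    ext x
    simp only [LinearMap.comp_apply, coordFun_apply, wCoeff_formMul, LinearMap.sum_apply,
      LinearMap.smul_apply]
    conv_lhs => rw [← (formBasis n).sum_repr (wCoeff r μ x)]
    simp only [Finset.mul_sum, mul_smul_comm, map_sum, map_smul, Finsupp.coe_finsetSum,
      Finset.sum_apply, Finsupp.smul_apply, smul_eq_mul, mul_comm]
  rw [this]
  exact Submodule.sum_mem _ fun S' _ => Submodule.smul_mem _ _ (coordFun_mem_span _ _ _)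

lemma coordFun_dirDeriv (a : Phase n → WFiber n) (u X : Phase n) (r : ℕ) (μ : Idx n →₀ ℕ)
    (S : Finset (Fin (n + n))) :
    coordFun r μ S (dirDeriv a u X) = fderiv ℝ (fun w => coordFun r μ S (a w)) u X := by
  have : wCoeff r μ (dirDeriv a u X) = ∑ S, (fderiv ℝ (fun w => coordFun r μ S (a w)) u X) •
    formBasis n S := wCoeff_mk _ r μ
  rw [coordFun_apply, this, (formBasis n).repr_sum_self]

section

variable {V : Set (Phase n)} {a b : Phase n → WFiber n}

lemma isSmoothSection_iff :
    IsSmoothSection V a ↔ ∀ r μ S, ContDiffOn ℝ ∞ (fun u => coordFun r μ S (a u)) V := Iff.rfl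

lemma differentiableAt_of_contDiffOn {E F : Type*} [NormedAddCommGroup E] [NormedSpace ℝ E]
    [NormedAddCommGroup F] [NormedSpace ℝ F] {V : Set E} (hV : IsOpen V) {f : E → F}
    (hf : ContDiffOn ℝ ∞ f V) {u : E} (hu : u ∈ V) : DifferentiableAt ℝ f u :=
  (hf.contDiffAt (hV.mem_nhds hu)).differentiableAt (by simp)

lemma isSymmSndFDerivAt_of_contDiffOn {E F : Type*} [NormedAddCommGroup E] [NormedSpace ℝ E]
    [NormedAddCommGroup F] [NormedSpace ℝ F] {V : Set E} (hV : IsOpen V) {f : E → F}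
    (hf : ContDiffOn ℝ ∞ f V) {u : E} (hu : u ∈ V) : IsSymmSndFDerivAt ℝ f u :=
  (hf.contDiffAt (hV.mem_nhds hu)).isSymmSndFDerivAt
    (by simpa using (WithTop.coe_le_coe.2 (le_top : (2 : ℕ∞) ≤ ⊤)))

/-- Smoothness and `dirDeriv` are defined component by component on infinitely many components. A
functional is compatible with them once it involves finitely many components; this is the purpose of
`RowFinite`. -/
lemma IsSmoothSection.span (ha : IsSmoothSection V a) {ℓ : WFiber n →ₗ[ℂ] ℂ}
    (hℓ : ℓ ∈ Submodule.span ℂ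
      (Set.range fun p : ℕ × (Idx n →₀ ℕ) × Finset (Fin (n + n)) => coordFun p.1 p.2.1 p.2.2)) :
    ContDiffOn ℝ ∞ (fun u => ℓ (a u)) V := by
  induction hℓ using Submodule.span_induction with
  | mem x hx => obtain ⟨p, rfl⟩ := hx; exact ha _ _ _
  | zero => simpa using contDiffOn_const
  | add x y _ _ hx hy => simpa using hx.add hy
  | smul c x _ hx => simpa using contDiffOn_const.mul hx

lemma IsSmoothSection.fderiv_span (hV : IsOpen V) (ha : IsSmoothSection V a)
    {ℓ : WFiber n →ₗ[ℂ] ℂ} (hℓ : ℓ ∈ Submodule.span ℂ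
      (Set.range fun p : ℕ × (Idx n →₀ ℕ) × Finset (Fin (n + n)) => coordFun p.1 p.2.1 p.2.2))
    {u : Phase n} (hu : u ∈ V) (X : Phase n) :
    fderiv ℝ (fun u => ℓ (a u)) u X = ℓ (dirDeriv a u X) := by
  induction hℓ using Submodule.span_induction with
  | mem x hx => obtain ⟨p, rfl⟩ := hx; exact (coordFun_dirDeriv _ _ _ _ _ _).symm
  | zero => simp
  | add x y hx' hy' hx hy =>
    simp only [LinearMap.add_apply, ← hx, ← hy]
    rw [fderiv_fun_add (differentiableAt_of_contDiffOn hV (ha.span hx') hu)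
      (differentiableAt_of_contDiffOn hV (ha.span hy') hu)]
    rfl
  | smul c x hx' hx =>
    simp only [LinearMap.smul_apply, smul_eq_mul, ← hx]
    rw [fderiv_const_mul (differentiableAt_of_contDiffOn hV (ha.span hx') hu)]
    rfl

lemma IsSmoothSection.map (ha : IsSmoothSection V a) {T : Module.End ℂ (WFiber n)}
    (hT : RowFinite T) : IsSmoothSection V fun u => T (a u) :=
  fun r μ S => ha.span (hT r μ S)

lemma dirDeriv_map (hV : IsOpen V) (ha : IsSmoothSection V a) {T : Module.End ℂ (WFiber n)}
    (hT : RowFinite T) {u : Phase n} (hu : u ∈ V) (X : Phase n) :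
    dirDeriv (fun u => T (a u)) u X = T (dirDeriv a u X) :=
  coordFun_ext fun r μ S => by
    rw [coordFun_dirDeriv]
    exact ha.fderiv_span hV (hT r μ S) hu X

lemma IsSmoothSection.differentiableAt (hV : IsOpen V) (ha : IsSmoothSection V a) {u : Phase n}
    (hu : u ∈ V) (r : ℕ) (μ : Idx n →₀ ℕ) (S : Finset (Fin (n + n))) :
    DifferentiableAt ℝ (fun u => coordFun r μ S (a u)) u :=
  differentiableAt_of_contDiffOn hV (ha r μ S) hu

lemma IsSmoothSection.sub (ha : IsSmoothSection V a) (hb : IsSmoothSection V b) :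
    IsSmoothSection V fun u => a u - b u := isSmoothSection_iff.2 fun r μ S => by
  simpa using (isSmoothSection_iff.1 ha r μ S).sub (isSmoothSection_iff.1 hb r μ S)

lemma IsSmoothSection.sum {ι : Type*} {s : Finset ι} {a : ι → Phase n → WFiber n}
    (ha : ∀ i, IsSmoothSection V (a i)) :
    IsSmoothSection V fun u => ∑ i ∈ s, a i u := isSmoothSection_iff.2 fun r μ S => by
  simpa using ContDiffOn.sum fun i _ => isSmoothSection_iff.1 (ha i) r μ S

lemma IsSmoothSection.smul (ha : IsSmoothSection V a) {f : Phase n → ℝ}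
    (hf : ContDiffOn ℝ ∞ f V) :
    IsSmoothSection V fun u => (f u : ℂ) • a u := isSmoothSection_iff.2 fun r μ S => by
  simpa [Pi.smul_def'] using hf.smul (isSmoothSection_iff.1 ha r μ S)

lemma IsSmoothSection.dirDeriv (hV : IsOpen V) (ha : IsSmoothSection V a) (X : Phase n) :
    IsSmoothSection V fun u => dirDeriv a u X := isSmoothSection_iff.2 fun r μ S => by
  simp only [coordFun_dirDeriv]
  exact ((isSmoothSection_iff.1 ha r μ S).fderiv_of_isOpen hV (m := ∞) (by simp)).clm_apply
    contDiffOn_const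

lemma dirDeriv_sub (hV : IsOpen V) (ha : IsSmoothSection V a) (hb : IsSmoothSection V b)
    {u : Phase n} (hu : u ∈ V) (X : Phase n) :
    dirDeriv (fun u => a u - b u) u X = dirDeriv a u X - dirDeriv b u X :=
  coordFun_ext fun r μ S => by
    simp only [coordFun_dirDeriv, map_sub]
    rw [fderiv_fun_sub (ha.differentiableAt hV hu r μ S) (hb.differentiableAt hV hu r μ S)]
    rfl

lemma dirDeriv_sum (hV : IsOpen V) {ι : Type*} {s : Finset ι} {a : ι → Phase n → WFiber n}
    (ha : ∀ i, IsSmoothSection V (a i)) {u : Phase n} (hu : u ∈ V) (X : Phase n) :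
    dirDeriv (fun u => ∑ i ∈ s, a i u) u X = ∑ i ∈ s, dirDeriv (a i) u X :=
  coordFun_ext fun r μ S => by
    simp only [coordFun_dirDeriv, map_sum]
    rw [fderiv_fun_sum fun i _ => (ha i).differentiableAt hV hu r μ S]
    simp

lemma dirDeriv_smul (hV : IsOpen V) (ha : IsSmoothSection V a) {f : Phase n → ℝ} {u : Phase n}
    (hf : DifferentiableAt ℝ f u) (hu : u ∈ V) (X : Phase n) :
    dirDeriv (fun u => (f u : ℂ) • a u) u X =
      (f u : ℂ) • dirDeriv a u X + (fderiv ℝ f u X : ℂ) • a u :=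
  coordFun_ext fun r μ S => by
    have h1 := fderiv_fun_smul hf (ha.differentiableAt hV hu r μ S)
    simp only [coordFun_dirDeriv, map_add, map_smul, smul_eq_mul]
    simp only [Complex.real_smul] at h1
    rw [h1]
    simp

lemma dirDeriv_dirDeriv_comm (hV : IsOpen V) (ha : IsSmoothSection V a) {u : Phase n}
    (hu : u ∈ V) (X Y : Phase n) :
    dirDeriv (fun w => dirDeriv a w X) u Y = dirDeriv (fun w => dirDeriv a w Y) u X :=
  coordFun_ext fun r μ S => by
    simp only [coordFun_dirDeriv]
    have h1 := isSmoothSection_iff.1 ha r μ S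
    have h2 := differentiableAt_of_contDiffOn hV (h1.fderiv_of_isOpen hV (m := ∞) (by simp)) hu
    have h3 := isSymmSndFDerivAt_of_contDiffOn hV h1 hu
    rw [fderiv_clm_apply h2 (differentiableAt_const _),
      fderiv_clm_apply h2 (differentiableAt_const _)]
    simpa using h3 Y X

end

/-! ### Smoothness of the geometric objects -/

section Smooth

variable {h f k : Phase n → ℝ} {V : Set (Phase n)}

lemma contDiffOn_fderiv_apply (hV : IsOpen V) (hf : ContDiffOn ℝ ∞ f V) {X : Phase n → Phase n}
    (hX : ContDiffOn ℝ ∞ X V) : ContDiffOn ℝ ∞ (fun u => fderiv ℝ f u (X u)) V :=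
  (hf.fderiv_of_isOpen hV (m := ∞) (by simp)).clm_apply hX

lemma contDiffOn_dX (hV : IsOpen V) (hf : ContDiffOn ℝ ∞ f V) (i : Fin n) :
    ContDiffOn ℝ ∞ (dX i f) V := contDiffOn_fderiv_apply hV hf contDiffOn_const

lemma contDiffOn_dP (hV : IsOpen V) (hf : ContDiffOn ℝ ∞ f V) (i : Fin n) :
    ContDiffOn ℝ ∞ (dP i f) V := contDiffOn_fderiv_apply hV hf contDiffOn_const

lemma contDiffOn_gUp (hV : IsOpen V) (hh : ContDiffOn ℝ ∞ h V) (a b : Fin n) :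
    ContDiffOn ℝ ∞ (fun u => gUp h u a b) V := contDiffOn_dP hV (contDiffOn_dP hV hh b) a

lemma contDiffOn_det {m : ℕ} {G : Phase n → Matrix (Fin m) (Fin m) ℝ}
    (hG : ∀ a b, ContDiffOn ℝ ∞ (fun u => G u a b) V) :
    ContDiffOn ℝ ∞ (fun u => (G u).det) V := by
  simp only [Matrix.det_apply]
  exact ContDiffOn.sum fun σ _ => (contDiffOn_prod fun i _ => hG _ _).const_smul _

/-- Cramer's rule: the entries of the inverse are determinants in the entries of `gUp`, divided by a
determinant without zeros on `V`. -/
lemma contDiffOn_gLow (hV : IsOpen V) (hh : ContDiffOn ℝ ∞ h V)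
    (hdet : ∀ u ∈ V, (gUp h u).det ≠ 0) (a b : Fin n) :
    ContDiffOn ℝ ∞ (fun u => gLow h u a b) V := by
  simp only [gLow, Matrix.inv_def, Ring.inverse_eq_inv', Matrix.smul_apply, smul_eq_mul,
    Matrix.adjugate_apply]
  refine ((contDiffOn_det fun a b => contDiffOn_gUp hV hh a b).inv hdet).mul
    (contDiffOn_det fun i j => ?_)
  -- The adjugate entry is the determinant of `gUp` with row `b` replaced by a constant unit row.
  by_cases hi : i = b
  · subst hi
    simpa using contDiffOn_const
  · simpa [Matrix.updateRow_ne hi] using contDiffOn_gUp hV hh i j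

lemma hamVec_fst (f : Phase n → ℝ) (u : Phase n) (j : Fin n) : (hamVec f u).1 j = dP j f u := by
  simp [hamVec, coordVec, Prod.fst_sum, Pi.single_apply]

lemma hamVec_snd (f : Phase n → ℝ) (u : Phase n) (j : Fin n) :
    (hamVec f u).2 j = -dX j f u := by
  simp [hamVec, coordVec, Prod.snd_sum, Pi.single_apply]

lemma contDiffOn_poisson (hV : IsOpen V) (hf : ContDiffOn ℝ ∞ f V) (hk : ContDiffOn ℝ ∞ k V) :
    ContDiffOn ℝ ∞ (poisson f k) V := by
  unfold poisson sympl
  simp only [hamVec_fst, hamVec_snd]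
  exact ContDiffOn.sum fun i _ => ((contDiffOn_dX hV hf i).neg.mul (contDiffOn_dP hV hk i)).sub
    ((contDiffOn_dX hV hk i).neg.mul (contDiffOn_dP hV hf i))

lemma contDiffOn_nConn (hV : IsOpen V) (hh : ContDiffOn ℝ ∞ h V)
    (hdet : ∀ u ∈ V, (gUp h u).det ≠ 0) (i j : Fin n) : ContDiffOn ℝ ∞ (nConn h i j) V := by
  have hg := contDiffOn_gLow hV hh hdet
  exact contDiffOn_const.mul ((contDiffOn_poisson hV (hg i j) hh).sub
    (ContDiffOn.sum fun k _ => ((contDiffOn_dP hV (contDiffOn_dX hV hh i) k).mul (hg j k)).add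
      ((contDiffOn_dP hV (contDiffOn_dX hV hh j) k).mul (hg i k))))

lemma contDiffOn_hVec (hV : IsOpen V) (hh : ContDiffOn ℝ ∞ h V)
    (hdet : ∀ u ∈ V, (gUp h u).det ≠ 0) (i : Fin n) : ContDiffOn ℝ ∞ (hVec h i) V :=
  contDiffOn_const.add (ContDiffOn.sum fun a _ =>
    (contDiffOn_nConn hV hh hdet i a).smul contDiffOn_const)

lemma contDiffOn_frame (hV : IsOpen V) (hh : ContDiffOn ℝ ∞ h V)
    (hdet : ∀ u ∈ V, (gUp h u).det ≠ 0) : ∀ α : Idx n, ContDiffOn ℝ ∞ (frame h α) V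
  | .inl i => contDiffOn_hVec hV hh hdet i
  | .inr b => contDiffOn_const.sub (ContDiffOn.sum fun i _ =>
      (contDiffOn_gUp hV hh b i).smul (contDiffOn_hVec hV hh hdet i))

lemma contDiffOn_vForm (hV : IsOpen V) (hh : ContDiffOn ℝ ∞ h V)
    (hdet : ∀ u ∈ V, (gUp h u).det ≠ 0) (b : Fin n) (X : Phase n) :
    ContDiffOn ℝ ∞ (fun u => vForm h b u X) V :=
  contDiffOn_const.sub (ContDiffOn.sum fun i _ =>
    (contDiffOn_nConn hV hh hdet i b).mul contDiffOn_const)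

lemma contDiffOn_coframe (hV : IsOpen V) (hh : ContDiffOn ℝ ∞ h V)
    (hdet : ∀ u ∈ V, (gUp h u).det ≠ 0) (X : Phase n) :
    ∀ α : Idx n, ContDiffOn ℝ ∞ (fun u => coframe h α u X) V
  | .inl i => contDiffOn_const.add (ContDiffOn.sum fun b _ =>
      (contDiffOn_gUp hV hh b i).mul (contDiffOn_vForm hV hh hdet b X))
  | .inr b => contDiffOn_vForm hV hh hdet b X

lemma contDiffOn_eD (hV : IsOpen V) (hh : ContDiffOn ℝ ∞ h V)
    (hdet : ∀ u ∈ V, (gUp h u).det ≠ 0) (hf : ContDiffOn ℝ ∞ f V) (α : Idx n) :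
    ContDiffOn ℝ ∞ (eD h α f) V :=
  contDiffOn_fderiv_apply hV hf (contDiffOn_frame hV hh hdet α)

lemma contDiffOn_anhA (hV : IsOpen V) (hh : ContDiffOn ℝ ∞ h V)
    (hdet : ∀ u ∈ V, (gUp h u).det ≠ 0) (m i j : Fin n) : ContDiffOn ℝ ∞ (anhA h m i j) V :=
  (contDiffOn_eD hV hh hdet (contDiffOn_nConn hV hh hdet j m) _).sub
    (contDiffOn_eD hV hh hdet (contDiffOn_nConn hV hh hdet i m) _)

lemma contDiffOn_anhB (hV : IsOpen V) (hh : ContDiffOn ℝ ∞ h V)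
    (hdet : ∀ u ∈ V, (gUp h u).det ≠ 0) (m k j : Fin n) : ContDiffOn ℝ ∞ (anhB h m k j) V :=
  have hN i a β := contDiffOn_eD hV hh hdet (contDiffOn_nConn hV hh hdet i a) β
  have hg := contDiffOn_gUp hV hh
  ContDiffOn.sum fun i _ => ContDiffOn.sum fun a _ =>
    (hg m i).mul (((hg k a).mul (hN i a _)).sub ((hg j a).mul (hN i a _)))

lemma contDiffOn_coefL (hV : IsOpen V) (hh : ContDiffOn ℝ ∞ h V)
    (hdet : ∀ u ∈ V, (gUp h u).det ≠ 0) (k i j : Fin n) : ContDiffOn ℝ ∞ (coefL h k i j) V :=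
  have hA := contDiffOn_anhA hV hh hdet
  have hg := contDiffOn_gUp hV hh
  have hl i j β := contDiffOn_eD hV hh hdet (contDiffOn_gLow hV hh hdet i j) β
  (contDiffOn_const.mul (ContDiffOn.sum fun m _ =>
    (hg k m).mul (((hl m i _).add (hl j m _)).sub (hl i j _)))).sub
  (contDiffOn_const.mul (ContDiffOn.sum fun m _ =>
    (hg k m).mul (((hA j i m).add (hA i j m)).add (hA m i j))))

lemma contDiffOn_coefC (hV : IsOpen V) (hh : ContDiffOn ℝ ∞ h V)
    (hdet : ∀ u ∈ V, (gUp h u).det ≠ 0) (i j k : Fin n) : ContDiffOn ℝ ∞ (coefC h i j k) V :=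
  have hB := contDiffOn_anhB hV hh hdet
  have hg := contDiffOn_gLow hV hh hdet
  have hl i j β := contDiffOn_eD hV hh hdet (contDiffOn_gUp hV hh i j) β
  (contDiffOn_const.mul (ContDiffOn.sum fun m _ =>
    (hg i m).mul (((hl m k _).add (hl j m _)).sub (hl j k _)))).sub
  (contDiffOn_const.mul (ContDiffOn.sum fun m _ =>
    (hg i m).mul (((hB j m k).add (hB k m j)).add (hB m k j))))

lemma contDiffOn_gam (hV : IsOpen V) (hh : ContDiffOn ℝ ∞ h V)
    (hdet : ∀ u ∈ V, (gUp h u).det ≠ 0) :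
    ∀ α β γ : Idx n, ContDiffOn ℝ ∞ (gam h α β γ) V
  | .inl k, .inl j, .inl i => contDiffOn_coefL hV hh hdet i j k
  | .inl k, .inr b, .inr c => (contDiffOn_coefL hV hh hdet b c k).neg
  | .inr a, .inl j, .inl k => contDiffOn_coefC hV hh hdet j k a
  | .inr a, .inr b, .inr c => (contDiffOn_coefC hV hh hdet c b a).neg
  | .inl _, .inl _, .inr _ => contDiffOn_const
  | .inr _, .inl _, .inr _ => contDiffOn_const
  | .inl _, .inr _, .inl _ => contDiffOn_const
  | .inr _, .inr _, .inl _ => contDiffOn_const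

end Smooth

/-! ### Symmetries -/

section Symmetry

variable {h : Phase n → ℝ} {V : Set (Phase n)} {u : Phase n}

lemma gUp_symm (hV : IsOpen V) (hh : ContDiffOn ℝ ∞ h V) (hu : u ∈ V) (a b : Fin n) :
    gUp h u a b = gUp h u b a := by
  have h2 := differentiableAt_of_contDiffOn hV (hh.fderiv_of_isOpen hV (m := ∞) (by simp)) hu
  have h3 := isSymmSndFDerivAt_of_contDiffOn hV hh hu
  simp only [gUp, Matrix.of_apply, dP]
  unfold dP
  rw [fderiv_clm_apply h2 (differentiableAt_const _),
    fderiv_clm_apply h2 (differentiableAt_const _)]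
  simpa using h3 _ _

lemma gUp_transpose (hV : IsOpen V) (hh : ContDiffOn ℝ ∞ h V) (hu : u ∈ V) :
    (gUp h u).transpose = gUp h u := by
  ext a b
  exact gUp_symm hV hh hu b a

lemma gLow_transpose (hV : IsOpen V) (hh : ContDiffOn ℝ ∞ h V) (hu : u ∈ V) :
    (gLow h u).transpose = gLow h u := by
  rw [gLow, Matrix.transpose_nonsing_inv, gUp_transpose hV hh hu]

lemma gLow_symm (hV : IsOpen V) (hh : ContDiffOn ℝ ∞ h V) (hu : u ∈ V) (a b : Fin n) :
    gLow h u a b = gLow h u b a := congrFun (congrFun (gLow_transpose hV hh hu) b) a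

/-- The bracket inherits its symmetry from `gLow`, and the other two terms are exchanged by swapping
the indices. Symmetry of `N` is what makes the horizontal distribution Lagrangian. -/
lemma nConn_symm (hV : IsOpen V) (hh : ContDiffOn ℝ ∞ h V) (hu : u ∈ V) (i j : Fin n) :
    nConn h i j u = nConn h j i u := by
  -- The bracket differentiates `gLow`, so its symmetry is needed on a neighbourhood of `u`, not
  -- only at `u`.
  have h1 : fderiv ℝ (fun w => gLow h w i j) u = fderiv ℝ (fun w => gLow h w j i) u :=
    Filter.EventuallyEq.fderiv_eq
      (Filter.eventuallyEq_of_mem (hV.mem_nhds hu) fun w hw => gLow_symm hV hh hw i j)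
  have h2 : poisson (fun w => gLow h w i j) h u = poisson (fun w => gLow h w j i) h u := by
    simp only [poisson, hamVec, dX, dP, h1]
  simp only [nConn, h2]
  congr 2
  exact Finset.sum_congr rfl fun k _ => add_comm _ _

end Symmetry

/-! ### The adapted frame -/

section Frame

variable (h : Phase n → ℝ) (u : Phase n)

lemma hVec_fst (i j : Fin n) : (hVec h i u).1 j = if j = i then 1 else 0 := by
  simp [hVec, coordVec, Prod.fst_sum]

lemma hVec_snd (i a : Fin n) : (hVec h i u).2 a = nConn h i a u := by
  simp [hVec, coordVec, Prod.snd_sum, Pi.single_apply]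

lemma frame_inr_fst (b i : Fin n) : (frame h (.inr b) u).1 i = -gUp h u b i := by
  simp [frame, coordVec, Prod.fst_sum, hVec_fst]

lemma frame_inr_snd (b a : Fin n) : (frame h (.inr b) u).2 a =
    (if a = b then 1 else 0) - ∑ i, gUp h u b i * nConn h i a u := by
  simp [frame, coordVec, Prod.snd_sum, hVec_snd]

lemma frame_inl_fst (i j : Fin n) : (frame h (.inl i) u).1 j = if j = i then 1 else 0 :=
  hVec_fst h u i j

lemma frame_inl_snd (i a : Fin n) : (frame h (.inl i) u).2 a = nConn h i a u :=
  hVec_snd h u i a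

lemma vForm_frame_inl (b i : Fin n) : vForm h b u (frame h (.inl i) u) = 0 := by
  simp [vForm, frame_inl_fst, frame_inl_snd]

lemma vForm_frame_inr (b c : Fin n) :
    vForm h b u (frame h (.inr c) u) = if b = c then 1 else 0 := by
  simp [vForm, frame_inr_fst, frame_inr_snd, mul_comm]

lemma coframe_frame (α β : Idx n) : coframe h α u (frame h β u) = if α = β then 1 else 0 := by
  rcases α with i | a <;> rcases β with j | b <;>
    simp [coframe, vForm_frame_inl, vForm_frame_inr, frame_inl_fst, frame_inr_fst]

/-- Every vector is expanded in the adapted frame by the coframe. -/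
lemma sum_coframe_frame (X : Phase n) : ∑ α, coframe h α u X • frame h α u = X := by
  rw [Fintype.sum_sum_type]
  refine Prod.ext ?_ ?_ <;> ext j
  · simp [Prod.fst_sum, frame_inl_fst, frame_inr_fst, coframe, mul_comm]
  · simp only [Prod.snd_add, Prod.snd_sum, PiLp.add_apply, WithLp.ofLp_sum, Prod.smul_snd,
      Finset.sum_apply, PiLp.smul_apply, smul_eq_mul, frame_inl_snd, frame_inr_snd, coframe,
      mul_sub, Finset.sum_sub_distrib, add_mul, Finset.sum_add_distrib, Finset.sum_mul,
      Finset.mul_sum]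
    rw [Finset.sum_comm (f := fun i b => gUp h u b i * vForm h b u X * nConn h i j u)]
    simp only [mul_ite, mul_one, mul_zero, Finset.sum_ite_eq, Finset.mem_univ, if_true]
    have : ∀ x y : Fin n, vForm h x u X * (gUp h u x y * nConn h y j u)
        = gUp h u x y * vForm h x u X * nConn h y j u := fun x y => by ring
    have hv : vForm h j u X = X.2 j - ∑ i, nConn h i j u * X.1 i := rfl
    simp only [this, hv, mul_comm (X.1 _)]
    ring

end Frame

/-! ### Block form of the symplectic form and of the metric in the adapted frame. -/

section Components

variable {h : Phase n → ℝ} {V : Set (Phase n)} {u : Phase n}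

lemma gUp_mul_gLow (hdet : (gUp h u).det ≠ 0) : gUp h u * gLow h u = 1 :=
  Matrix.mul_nonsing_inv _ hdet.isUnit

lemma gLow_mul_gUp (hdet : (gUp h u).det ≠ 0) : gLow h u * gUp h u = 1 :=
  Matrix.nonsing_inv_mul _ hdet.isUnit

/-- Up to sign the adapted frame is a symplectic frame: the `e_i` are isotropic by symmetry of `N`,
and subtracting `g^{bi} e_i` keeps the `e^b` isotropic by symmetry of `g` and `N`. The entries do
not depend on the point. -/
lemma thetaLow_eq (hV : IsOpen V) (hh : ContDiffOn ℝ ∞ h V) (hu : u ∈ V) :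
    Matrix.of (thetaLow h u) = Matrix.fromBlocks 0 (-1) 1 0 := by
  have hg := gUp_symm hV hh hu
  have hN := nConn_symm hV hh hu
  ext α β
  rcases α with i | a <;> rcases β with j | b <;>
    simp only [Matrix.of_apply, thetaLow, sympl, frame_inl_fst, frame_inl_snd, frame_inr_fst,
      frame_inr_snd, Matrix.fromBlocks_apply₁₁, Matrix.fromBlocks_apply₁₂,
      Matrix.fromBlocks_apply₂₁, Matrix.fromBlocks_apply₂₂, Matrix.zero_apply, Matrix.neg_apply,
      Matrix.one_apply, Finset.sum_sub_distrib]
  · simp [hN i j]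
  · simp [hN i, mul_comm, eq_comm]
    ring
  · simp [hN j, mul_comm, eq_comm]
  · simp only [sub_mul, Finset.sum_sub_distrib, Finset.sum_mul, ite_mul, one_mul, zero_mul,
      Finset.sum_ite_eq', Finset.mem_univ, if_true, mul_neg, Finset.sum_neg_distrib, hg b a]
    rw [Finset.sum_comm (f := fun x i => gUp h u b i * nConn h i x u * gUp h u a x)]
    have : ∀ x y : Fin n, gUp h u b x * nConn h x y u * gUp h u a y =
      gUp h u a y * nConn h y x u * gUp h u b x := fun x y => by rw [hN x y]; ring
    simp only [this]
    rw [Finset.sum_comm]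
    ring

/-- Since `e^b` has base component `-g^{bi}`, the summand `g_{ij} dx^i dx^j` contributes `-1` off
the diagonal and one copy of `g^{ab}` below. The other copy comes from `g^{ab} e_a e_b`. -/
lemma metric_frame (hV : IsOpen V) (hh : ContDiffOn ℝ ∞ h V) (hdet : (gUp h u).det ≠ 0)
    (hu : u ∈ V) : (Matrix.of fun α β => metric h u (frame h α u) (frame h β u)) =
      Matrix.fromBlocks (gLow h u) (-1) (-1) ((2 : ℝ) • gUp h u) := by
  have h1 : ∀ i j, ∑ k, gUp h u i k * gLow h u k j = (1 : Matrix (Fin n) (Fin n) ℝ) i j :=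
    fun i j => by rw [← gUp_mul_gLow hdet, Matrix.mul_apply]
  have hg := gUp_symm hV hh hu
  have hl := gLow_symm hV hh hu
  ext α β
  rcases α with i | a <;> rcases β with j | b <;>
    simp only [Matrix.of_apply, metric, frame_inl_fst, vForm_frame_inl, vForm_frame_inr,
      frame_inr_fst, Matrix.fromBlocks_apply₁₁, Matrix.fromBlocks_apply₁₂,
      Matrix.fromBlocks_apply₂₁, Matrix.fromBlocks_apply₂₂, Matrix.neg_apply, Matrix.smul_apply]
  · simp
  · have := h1 b i
    rw [Matrix.one_apply] at this
    simp only [eq_comm (a := b)] at this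
    simp [Matrix.one_apply, ← this, hl i, mul_comm]
  · have := h1 a j
    simp [mul_comm (gLow h u _ _), this]
  · have h2 : ∑ i, ∑ j, gLow h u i j * -gUp h u a i * -gUp h u b j = gUp h u a b := by
      rw [Finset.sum_comm]
      have h3 : ∀ i j, gLow h u i j * -gUp h u a i * -gUp h u b j =
        (gUp h u a i * gLow h u i j) * gUp h u b j := fun i j => by ring
      simp only [h3, ← Finset.sum_mul, h1]
      simp [Matrix.one_apply, hg b a]
    rw [h2]
    simp [two_mul]

lemma metricInv_eq (hV : IsOpen V) (hh : ContDiffOn ℝ ∞ h V) (hdet : (gUp h u).det ≠ 0)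
    (hu : u ∈ V) : metricInv h u = Matrix.fromBlocks ((2 : ℝ) • gUp h u) 1 1 (gLow h u) := by
  rw [metricInv, metric_frame hV hh hdet hu]
  refine Matrix.inv_eq_right_inv ?_
  rw [Matrix.fromBlocks_multiply, ← Matrix.fromBlocks_one]
  simp [gLow_mul_gUp hdet, gUp_mul_gLow hdet, two_smul, Matrix.add_mul, Matrix.mul_add]

lemma metricInv_symm (hV : IsOpen V) (hh : ContDiffOn ℝ ∞ h V) (hdet : (gUp h u).det ≠ 0)
    (hu : u ∈ V) (α β : Idx n) : metricInv h u α β = metricInv h u β α := by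
  have : (metricInv h u).transpose = metricInv h u := by
    rw [metricInv_eq hV hh hdet hu, Matrix.fromBlocks_transpose]
    simp [gUp_transpose hV hh hu, gLow_transpose hV hh hu]
  exact congrFun (congrFun this β) α

/-- Raising both indices with the metric leaves the matrix of `θ` unchanged. Equivalently, `g^{αγ}
θ_{γβ}` squares to `-1`, so metric and symplectic form are compatible; this later makes `θ^{αβ}
θ_{ατ}` the identity. -/
lemma thetaUp_eq (hV : IsOpen V) (hh : ContDiffOn ℝ ∞ h V) (hdet : (gUp h u).det ≠ 0)
    (hu : u ∈ V) : Matrix.of (thetaUp h u) = Matrix.fromBlocks 0 (-1) 1 0 := by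
  have h1 : Matrix.of (thetaUp h u) =
      metricInv h u * Matrix.of (thetaLow h u) * (metricInv h u).transpose := by
    ext α β
    simp only [Matrix.of_apply, thetaUp, Matrix.mul_apply, Matrix.transpose_apply, Finset.sum_mul]
    rw [Finset.sum_comm]
    exact Finset.sum_congr rfl fun γ _ => Finset.sum_congr rfl fun δ _ => by ring
  rw [h1, thetaLow_eq hV hh hu, metricInv_eq hV hh hdet hu, Matrix.fromBlocks_transpose,
    Matrix.fromBlocks_multiply, Matrix.fromBlocks_multiply]
  simp only [gUp_transpose hV hh hu, gLow_transpose hV hh hu, Matrix.transpose_smul,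
    Matrix.transpose_one]
  congr 1 <;> simp [gLow_mul_gUp hdet, gUp_mul_gLow hdet, two_smul, Matrix.add_mul, Matrix.mul_add]

end Components

/-! ### Derivatives of 1-forms and Lie brackets -/

section Exterior

variable {E : Type*} [NormedAddCommGroup E] [NormedSpace ℝ E]

/-- The formula `dη(Y, X) = Y(η(X)) - X(η(Y)) + η([X, Y])`. -/
lemma fderiv_form_lieBracket {η : E → E →L[ℝ] ℝ} {X Y : E → E} {u : E}
    (hη : DifferentiableAt ℝ η u) (hX : DifferentiableAt ℝ X u) (hY : DifferentiableAt ℝ Y u) :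
    fderiv ℝ (fun w => η w (X w)) u (Y u) - fderiv ℝ (fun w => η w (Y w)) u (X u)
      + η u (VectorField.lieBracket ℝ X Y u) =
    fderiv ℝ η u (Y u) (X u) - fderiv ℝ η u (X u) (Y u) := by
  rw [fderiv_clm_apply hη hX, fderiv_clm_apply hη hY, VectorField.lieBracket]
  simp
  ring

end Exterior

/-! ### Metric compatibility of the connection and the symmetries of its curvature. -/

section Connection

variable {h f g : Phase n → ℝ} {V : Set (Phase n)} {u : Phase n}

lemma sum_anh_smul_frame (h : Phase n → ℝ) (u : Phase n) (α β : Idx n) :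
    ∑ σ, anh h α β σ u • frame h σ u = VectorField.lieBracket ℝ (frame h α) (frame h β) u :=
  sum_coframe_frame h u _

/-- This is `d(df) = 0` on a pair of frame vectors: `fderiv_form_lieBracket` for the form `df`,
whose right-hand side vanishes by symmetry of the second derivative. -/
lemma eD_eD_comm (hV : IsOpen V) (hh : ContDiffOn ℝ ∞ h V)
    (hdet : ∀ u ∈ V, (gUp h u).det ≠ 0) (hf : ContDiffOn ℝ ∞ f V) (hu : u ∈ V) (α β : Idx n) :
    eD h β (eD h α f) u - eD h α (eD h β f) u + ∑ σ, anh h α β σ u * eD h σ f u = 0 := by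
  have hη := differentiableAt_of_contDiffOn hV (hf.fderiv_of_isOpen hV (m := ∞) (by simp)) hu
  have hF α := differentiableAt_of_contDiffOn hV (contDiffOn_frame hV hh hdet α) hu
  have h1 := fderiv_form_lieBracket hη (hF α) (hF β)
  rw [isSymmSndFDerivAt_of_contDiffOn hV hf hu (frame h β u) (frame h α u), sub_self,
    ← sum_anh_smul_frame h u α β, map_sum] at h1
  simp only [map_smul, smul_eq_mul] at h1
  exact h1

lemma eD_congr (hV : IsOpen V) (hu : u ∈ V) (hfg : ∀ w ∈ V, f w = g w) (α : Idx n) :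
    eD h α f u = eD h α g u := by
  rw [eD, eD, Filter.EventuallyEq.fderiv_eq (Filter.eventuallyEq_of_mem (hV.mem_nhds hu) hfg)]

lemma eD_const (c : ℝ) (α : Idx n) : eD h α (fun _ => c) u = 0 := by
  simp [eD]

lemma eD_neg (α : Idx n) : eD h α (fun w => -f w) u = -eD h α f u := by
  simp [eD, fderiv_fun_neg]

lemma eD_add (hV : IsOpen V) (hf : ContDiffOn ℝ ∞ f V) (hg : ContDiffOn ℝ ∞ g V) (hu : u ∈ V)
    (α : Idx n) : eD h α (fun w => f w + g w) u = eD h α f u + eD h α g u := by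
  rw [eD, fderiv_fun_add (differentiableAt_of_contDiffOn hV hf hu)
    (differentiableAt_of_contDiffOn hV hg hu)]
  rfl

/-- The entrywise derivative of a matrix-valued function along the adapted frame. -/
def eDMat (h : Phase n → ℝ) (α : Idx n) (A : Phase n → Matrix (Fin n) (Fin n) ℝ) (u : Phase n) :
    Matrix (Fin n) (Fin n) ℝ :=
  Matrix.of fun i j => eD h α (fun w => A w i j) u

lemma eDMat_mul (hV : IsOpen V) {A B : Phase n → Matrix (Fin n) (Fin n) ℝ}
    (hA : ∀ i j, ContDiffOn ℝ ∞ (fun u => A u i j) V)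
    (hB : ∀ i j, ContDiffOn ℝ ∞ (fun u => B u i j) V) (hu : u ∈ V) (α : Idx n) :
    eDMat h α (fun w => A w * B w) u = eDMat h α A u * B u + A u * eDMat h α B u := by
  ext i j
  have hA' i j := differentiableAt_of_contDiffOn hV (hA i j) hu
  have hB' i j := differentiableAt_of_contDiffOn hV (hB i j) hu
  simp only [eDMat, eD, Matrix.of_apply, Matrix.mul_apply, Matrix.add_apply]
  rw [fderiv_fun_sum fun k _ => (hA' i k).fun_mul (hB' k j), sum_apply,
    ← Finset.sum_add_distrib]
  refine Finset.sum_congr rfl fun k _ => ?_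
  rw [fderiv_fun_mul (hA' i k) (hB' k j)]
  simp
  ring

/-- The block `Γ^i_{αj}` of the connection coefficients. -/
def gamMat (h : Phase n → ℝ) (α : Idx n) (u : Phase n) : Matrix (Fin n) (Fin n) ℝ :=
  Matrix.of fun i j => gam h α (.inl j) (.inl i) u

/-- The connection on the `e^b` is dual to the connection on the `e_j`. As `θ` pairs the two blocks
by constants, this duality is the reason `θ` is parallel. -/
lemma gam_inr_inr (α : Idx n) (b c : Fin n) :
    gam h α (.inr b) (.inr c) = fun u => -gam h α (.inl c) (.inl b) u := by
  rcases α with k | a <;> rfl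

lemma gam_inl_inr (α : Idx n) (b c : Fin n) : gam h α (.inl b) (.inr c) = fun _ => 0 := by
  rcases α with k | a <;> rfl

lemma gam_inr_inl (α : Idx n) (b c : Fin n) : gam h α (.inr b) (.inl c) = fun _ => 0 := by
  rcases α with k | a <;> rfl

lemma contDiffOn_gamMat (hV : IsOpen V) (hh : ContDiffOn ℝ ∞ h V)
    (hdet : ∀ u ∈ V, (gUp h u).det ≠ 0) (α : Idx n) (i j : Fin n) :
    ContDiffOn ℝ ∞ (fun u => gamMat h α u i j) V := contDiffOn_gam hV hh hdet _ _ _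

lemma anhA_antisymm (m i j : Fin n) : anhA h m i j u = -anhA h m j i u := by
  simp [anhA, omegaN]

lemma anhB_antisymm (m i j : Fin n) : anhB h m i j u = -anhB h m j i u := by
  simp only [anhB, ← Finset.sum_neg_distrib]
  exact Finset.sum_congr rfl fun k _ => Finset.sum_congr rfl fun l _ => by ring

/-- Differentiate `gUp * gLow = 1`, which holds on all of `V`, and multiply by `gUp` on the right.
-/
lemma eDMat_gUp_of_gLow (hV : IsOpen V) (hh : ContDiffOn ℝ ∞ h V)
    (hdet : ∀ u ∈ V, (gUp h u).det ≠ 0) (hu : u ∈ V) (α : Idx n) :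
    eDMat h α (gUp h) u = -(gUp h u * eDMat h α (gLow h) u * gUp h u) := by
  have h1 := eDMat_mul (h := h) hV (contDiffOn_gUp hV hh) (contDiffOn_gLow hV hh hdet) hu α
  have h2 : eDMat h α (fun w => gUp h w * gLow h w) u = 0 := by
    ext i j
    have : ∀ w ∈ V, (gUp h w * gLow h w) i j = (1 : Matrix (Fin n) (Fin n) ℝ) i j :=
      fun w hw => by rw [gUp_mul_gLow (hdet w hw)]
    rw [eDMat, Matrix.of_apply, eD_congr hV hu this, eD_const]
    rfl
  rw [h2] at h1
  have h3 : eDMat h α (gUp h) u * gLow h u * gUp h u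
      = -(gUp h u * eDMat h α (gLow h) u * gUp h u) := by
    rw [eq_neg_iff_add_eq_zero, ← Matrix.add_mul, ← h1, Matrix.zero_mul]
  rwa [Matrix.mul_assoc, gLow_mul_gUp (hdet u hu), Matrix.mul_one] at h3

/-- The connection is compatible with the fundamental tensor. -/
lemma eDMat_gUp (hV : IsOpen V) (hh : ContDiffOn ℝ ∞ h V)
    (hdet : ∀ u ∈ V, (gUp h u).det ≠ 0) (hu : u ∈ V) (α : Idx n) :
    eDMat h α (gUp h) u =
      -(gamMat h α u * gUp h u) - (gamMat h α u * gUp h u).transpose := by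
  have hG := gUp_transpose hV hh hu
  rcases α with k | k
  -- `Z` is the coefficient `L` with its upper index lowered, as in the Koszul formula.
  · let Z : Matrix (Fin n) (Fin n) ℝ := Matrix.of fun m j =>
      (1 / 2) * (eD h (.inl k) (fun w => gLow h w m j) u
        + eD h (.inl j) (fun w => gLow h w k m) u - eD h (.inl m) (fun w => gLow h w j k) u)
      - (1 / 2) * (anhA h k j m u + anhA h j k m u + anhA h m j k u)
    have hZ : gamMat h (.inl k) u = gUp h u * Z := by
      ext i j
      simp only [gamMat, Matrix.of_apply, gam, coefL, Matrix.mul_apply, Z, Finset.mul_sum,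
        ← Finset.sum_sub_distrib]
      exact Finset.sum_congr rfl fun m _ => by ring
    -- Symmetrizing keeps only the derivative along `e_k`. The `anhA` terms cancel in pairs, being
    -- antisymmetric in their last two indices, so the torsion they create does not affect
    -- compatibility.
    have hZ' : Z + Z.transpose = eDMat h (.inl k) (gLow h) u := by
      ext i j
      simp only [Matrix.add_apply, Matrix.transpose_apply, Z, Matrix.of_apply, eDMat]
      have hs : ∀ (α : Idx n) i j, eD h α (fun w => gLow h w i j) u =
        eD h α (fun w => gLow h w j i) u :=
        fun α i j => eD_congr hV hu (fun w hw => gLow_symm hV hh hw i j) α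
      rw [hs _ j i, hs _ k i, hs _ k j, anhA_antisymm k j i, anhA_antisymm j k i,
        anhA_antisymm i k j]
      ring
    rw [eDMat_gUp_of_gLow hV hh hdet hu, ← hZ', hZ, Matrix.transpose_mul, Matrix.transpose_mul,
      hG]
    noncomm_ring
  · let Y : Matrix (Fin n) (Fin n) ℝ := Matrix.of fun m j =>
      -(1 / 2) * (eD h (.inr j) (fun w => gUp h w m k) u
        + eD h (.inr k) (fun w => gUp h w j m) u - eD h (.inr m) (fun w => gUp h w j k) u)
      - (1 / 2) * (anhB h j m k u + anhB h k m j u + anhB h m k j u)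
    -- The transpose appears because `C_i^{jk}` carries the row index of `gamMat` as its upper index
    -- `j`, while `gLow` contracts with the lower index `i`.
    have hY : gamMat h (.inr k) u = (gLow h u * Y).transpose := by
      ext i j
      simp only [gamMat, Matrix.of_apply, gam, coefC, Matrix.mul_apply, Y, Finset.mul_sum,
        ← Finset.sum_sub_distrib, Matrix.transpose_apply]
      exact Finset.sum_congr rfl fun m _ => by ring
    have hY' : Y + Y.transpose = -eDMat h (.inr k) (gUp h) u := by
      ext i j
      simp only [Matrix.add_apply, Matrix.transpose_apply, Y, Matrix.of_apply, eDMat,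
        Matrix.neg_apply]
      have hs : ∀ (α : Idx n) i j, eD h α (fun w => gUp h w i j) u =
        eD h α (fun w => gUp h w j i) u :=
        fun α i j => eD_congr hV hu (fun w hw => gUp_symm hV hh hw i j) α
      rw [hs _ j i, anhB_antisymm j i k, anhB_antisymm k i j, anhB_antisymm i k j]
      ring
    have h1 : gamMat h (.inr k) u * gUp h u = Y.transpose := by
      rw [hY, Matrix.transpose_mul, gLow_transpose hV hh hu, Matrix.mul_assoc,
        gLow_mul_gUp (hdet u hu), Matrix.mul_one]
    rw [h1, Matrix.transpose_transpose, ← neg_neg (eDMat _ _ _ _), ← hY']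
    abel

/-- The block `R^i_{jαβ}` of the curvature. -/
def curvMat (h : Phase n → ℝ) (α β : Idx n) (u : Phase n) : Matrix (Fin n) (Fin n) ℝ :=
  Matrix.of fun i j => curv h (.inl i) (.inl j) α β u

/-- The connection preserves the splitting, so the sum over the intermediate index reduces to one
block. Rows of `gamMat` are upper indices, which puts the factor with index `β` on the left in the
first product. -/
lemma curvMat_eq (α β : Idx n) : curvMat h α β u =
    eDMat h β (gamMat h α) u - eDMat h α (gamMat h β) u
      + (gamMat h β u * gamMat h α u - gamMat h α u * gamMat h β u)
      + ∑ σ, anh h α β σ u • gamMat h σ u := by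
  ext i j
  simp only [curvMat, curv, Matrix.of_apply, Finset.sum_add_distrib, Matrix.add_apply,
    Matrix.sub_apply, Matrix.mul_apply, Matrix.sum_apply, Matrix.smul_apply, smul_eq_mul,
    Finset.sum_sub_distrib]
  rw [Fintype.sum_sum_type (f := fun σ => gam h α (.inl j) σ u * gam h β σ (.inl i) u),
    Fintype.sum_sum_type (f := fun σ => gam h β (.inl j) σ u * gam h α σ (.inl i) u)]
  simp only [gam_inl_inr, gam_inr_inl, mul_zero, Finset.sum_const_zero, add_zero, eDMat, gamMat,
    Matrix.of_apply, mul_comm (gam h α (.inl j) _ u), mul_comm (gam h β (.inl j) _ u)]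
  ring

/-- The curvature of a dual connection is minus the transpose of the original curvature. -/
lemma curv_inr_inr (α β : Idx n) (b c : Fin n) :
    curv h (.inr c) (.inr b) α β u = -curv h (.inl b) (.inl c) α β u := by
  simp only [curv, Finset.sum_add_distrib, Finset.sum_sub_distrib]
  simp only [Fintype.sum_sum_type (f := fun σ => gam h _ _ σ u * gam h _ σ _ u)]
  simp only [gam_inl_inr, gam_inr_inl, mul_zero, Finset.sum_const_zero, add_zero, zero_add,
    gam_inr_inr, eD_neg, mul_neg, neg_neg, Finset.sum_neg_distrib, mul_comm]
  ring

lemma curv_inl_inr (α β : Idx n) (b c : Fin n) : curv h (.inl c) (.inr b) α β u = 0 := by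
  simp only [curv, Finset.sum_add_distrib, Finset.sum_sub_distrib]
  simp only [Fintype.sum_sum_type (f := fun σ => gam h _ _ σ u * gam h _ σ _ u)]
  simp [gam_inr_inl, eD_const]

lemma curv_inr_inl (α β : Idx n) (b c : Fin n) : curv h (.inr c) (.inl b) α β u = 0 := by
  simp only [curv, Finset.sum_add_distrib, Finset.sum_sub_distrib]
  simp only [Fintype.sum_sum_type (f := fun σ => gam h _ _ σ u * gam h _ σ _ u)]
  simp [gam_inl_inr, eD_const]

lemma curv_eq_fromBlocks (α β : Idx n) : (Matrix.of fun τ φ => curv h τ φ α β u) =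
    Matrix.fromBlocks (curvMat h α β u) 0 0 (-(curvMat h α β u).transpose) := by
  ext τ φ
  rcases τ with i | a <;> rcases φ with j | b <;>
    simp [curvMat, curv_inr_inr, curv_inl_inr, curv_inr_inl]

/-- The curvature is skew with respect to the fundamental tensor. -/
lemma curvMat_mul_gUp (hV : IsOpen V) (hh : ContDiffOn ℝ ∞ h V)
    (hdet : ∀ u ∈ V, (gUp h u).det ≠ 0) (hu : u ∈ V) (α β : Idx n) :
    (curvMat h α β u * gUp h u).transpose = -(curvMat h α β u * gUp h u) := by
  have hG := gUp_transpose hV hh hu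
  have hg := contDiffOn_gUp hV hh
  have hP := contDiffOn_gamMat hV hh hdet
  have hPG : ∀ α i j, ContDiffOn ℝ ∞ (fun u => (gamMat h α u * gUp h u) i j) V := fun α i j => by
    simp only [Matrix.mul_apply]
    exact ContDiffOn.sum fun k _ => (hP α i k).mul (hg k j)
  let D : Idx n → Idx n → Matrix (Fin n) (Fin n) ℝ := fun β α =>
    eDMat h β (fun w => gamMat h α w * gUp h w) u
  have h1 : ∀ α β, D β α = eDMat h β (gamMat h α) u * gUp h u + gamMat h α u *
      (-(gamMat h β u * gUp h u) - (gamMat h β u * gUp h u).transpose) := fun α β => by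
    rw [← eDMat_gUp hV hh hdet hu]
    exact eDMat_mul hV (hP α) hg hu β
  -- Compatibility is substituted on all of `V` before the second derivative is taken.
  have h2 : ∀ α β i j, eD h β (eD h α fun w => gUp h w i j) u = -(D β α i j + D β α j i) :=
    fun α β i j => by
      have : ∀ w ∈ V, eD h α (fun w => gUp h w i j) w =
          -((gamMat h α w * gUp h w) i j + (gamMat h α w * gUp h w) j i) := fun w hw => by
        have := congrFun (congrFun (eDMat_gUp hV hh hdet hw α) i) j
        simp only [eDMat, Matrix.of_apply, Matrix.sub_apply, Matrix.neg_apply,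
          Matrix.transpose_apply] at this
        rw [this]
        ring
      rw [eD_congr hV hu this, eD_neg, eD_add hV (hPG α i j) (hPG α j i) hu]
      rfl
  let W : Matrix (Fin n) (Fin n) ℝ := ∑ σ, anh h α β σ u • gamMat h σ u
  -- This is the commutator identity `eD_eD_comm` applied to the functions `g^{ij}`.
  have h3 : (D β α - D α β + W * gUp h u) + (D β α - D α β + W * gUp h u).transpose = 0 := by
    ext i j
    have := eD_eD_comm hV hh hdet (hg i j) hu α β
    have h4 : ∑ σ, anh h α β σ u * eD h σ (fun w => gUp h w i j) u =
        -((W * gUp h u) i j + (W * gUp h u) j i) := by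
      simp only [W, Matrix.sum_mul, Matrix.sum_apply, Matrix.smul_mul, Matrix.smul_apply,
        smul_eq_mul, ← Finset.sum_add_distrib, ← Finset.sum_neg_distrib]
      refine Finset.sum_congr rfl fun σ _ => ?_
      have := congrFun (congrFun (eDMat_gUp hV hh hdet hu σ) i) j
      simp only [eDMat, Matrix.of_apply, Matrix.sub_apply, Matrix.neg_apply,
        Matrix.transpose_apply] at this
      rw [this]
      ring
    rw [h2, h2, h4] at this
    simp only [Matrix.add_apply, Matrix.sub_apply, Matrix.transpose_apply, Matrix.zero_apply]
    linarith
  -- Expanding `D`, the bracket equals the curvature times `gUp` plus `Γ_β g Γ_αᵀ - Γ_α g Γ_βᵀ`. The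
  -- latter is antisymmetric, hence disappears when the transpose is added.
  rw [h1, h1] at h3
  rw [curvMat_eq, ← add_eq_zero_iff_eq_neg, ← h3]
  simp only [Matrix.add_mul, Matrix.sub_mul, Matrix.mul_sub, Matrix.transpose_add,
    Matrix.transpose_sub, Matrix.transpose_mul, Matrix.transpose_neg, Matrix.mul_neg, hG,
    Matrix.transpose_transpose, Matrix.mul_assoc]
  abel

/-- The curvature with the upper index lowered by the symplectic form is symmetric. -/
lemma thetaLow_curv_symm (hV : IsOpen V) (hh : ContDiffOn ℝ ∞ h V) (hu : u ∈ V)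
    (α β γ φ : Idx n) :
    ∑ τ, thetaLow h u γ τ * curv h τ φ α β u = ∑ τ, thetaLow h u φ τ * curv h τ γ α β u := by
  have h1 : (Matrix.of (thetaLow h u) * Matrix.of fun τ φ => curv h τ φ α β u).transpose =
      Matrix.of (thetaLow h u) * Matrix.of fun τ φ => curv h τ φ α β u := by
    rw [thetaLow_eq hV hh hu, curv_eq_fromBlocks, Matrix.fromBlocks_multiply,
      Matrix.fromBlocks_transpose]
    simp
  simpa [Matrix.mul_apply] using congrFun (congrFun h1 φ) γ

/-- The curvature with the lower index raised by the metric is skew-symmetric. -/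
lemma curv_metricInv_skew (hV : IsOpen V) (hh : ContDiffOn ℝ ∞ h V)
    (hdet : ∀ u ∈ V, (gUp h u).det ≠ 0) (hu : u ∈ V) (α β μ ν : Idx n) :
    ∑ φ, curv h μ φ α β u * metricInv h u φ ν = -∑ φ, curv h ν φ α β u * metricInv h u φ μ := by
  have hQ := curvMat_mul_gUp hV hh hdet hu α β
  have hG := gUp_transpose hV hh hu
  have hL := gLow_transpose hV hh hu
  -- The lower diagonal block needs skewness with respect to `gLow`: conjugate the relation for
  -- `gUp` by `gLow` on both sides.
  have h2 : gLow h u * curvMat h α β u = -((curvMat h α β u).transpose * gLow h u) := by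
    have h3 := congrArg (fun A => gLow h u * A * gLow h u) hQ
    simp only [Matrix.transpose_mul, hG] at h3
    rw [← Matrix.mul_assoc, gLow_mul_gUp (hdet u hu), Matrix.one_mul, Matrix.mul_neg,
      Matrix.neg_mul, Matrix.mul_assoc, Matrix.mul_assoc, gUp_mul_gLow (hdet u hu),
      Matrix.mul_one] at h3
    rw [h3, neg_neg]
  have h1 : ((Matrix.of fun τ φ => curv h τ φ α β u) * metricInv h u).transpose =
      -((Matrix.of fun τ φ => curv h τ φ α β u) * metricInv h u) := by
    rw [metricInv_eq hV hh (hdet u hu) hu, curv_eq_fromBlocks, Matrix.fromBlocks_multiply,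
      Matrix.fromBlocks_transpose, Matrix.fromBlocks_neg]
    simp [hQ, h2, hL]
  simpa [Matrix.mul_apply] using congrFun (congrFun h1 ν) μ

end Connection

/-! ### Linear and quadratic operators of a Weyl algebra -/

section Weyl

variable {ι E : Type*} [Fintype ι] [AddCommGroup E] [Module ℂ E]

/-- The linear combination `c_α d_α` of operators. -/
def linComb (d : ι → Module.End ℂ E) (c : ι → ℝ) : Module.End ℂ E := ∑ α, (c α : ℂ) • d α

/-- The quadratic combination `M_{βγ} z_β d_γ` of operators. -/
def quadComb (z d : ι → Module.End ℂ E) (M : Matrix ι ι ℝ) : Module.End ℂ E :=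
  ∑ β, ∑ γ, (M β γ : ℂ) • (z β * d γ)

variable {z d : ι → Module.End ℂ E}

lemma linComb_apply (c : ι → ℝ) (x : E) : linComb d c x = ∑ α, (c α : ℂ) • d α x := by
  simp only [linComb, LinearMap.sum_apply, LinearMap.smul_apply]

lemma quadComb_apply (M : Matrix ι ι ℝ) (x : E) :
    quadComb z d M x = ∑ β, ∑ γ, (M β γ : ℂ) • z β (d γ x) := by
  simp only [quadComb, LinearMap.sum_apply, LinearMap.smul_apply, Module.End.mul_apply]

lemma linComb_add (c c' : ι → ℝ) : linComb d (c + c') = linComb d c + linComb d c' := by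
  simp only [linComb, Pi.add_apply, Complex.ofReal_add, add_smul, Finset.sum_add_distrib]

lemma linComb_sub (c c' : ι → ℝ) : linComb d (c - c') = linComb d c - linComb d c' := by
  simp only [linComb, Pi.sub_apply, Complex.ofReal_sub, sub_smul, Finset.sum_sub_distrib]

lemma quadComb_sub (M N : Matrix ι ι ℝ) :
    quadComb z d (M - N) = quadComb z d M - quadComb z d N := by
  simp only [quadComb, Matrix.sub_apply, Complex.ofReal_sub, sub_smul, Finset.sum_sub_distrib]

lemma linComb_neg (c : ι → ℝ) : linComb d (-c) = -linComb d c := by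
  simp only [linComb, Pi.neg_apply, Complex.ofReal_neg, neg_smul, Finset.sum_neg_distrib]

lemma linComb_sum_smul {κ : Type*} [Fintype κ] (r : κ → ℝ) (c : κ → ι → ℝ) :
    linComb d (fun α => ∑ i, r i * c i α) = ∑ i, (r i : ℂ) • linComb d (c i) := by
  simp only [linComb, Complex.ofReal_sum, Complex.ofReal_mul, Finset.sum_smul, Finset.smul_sum,
    smul_smul]
  exact Finset.sum_comm

lemma quadComb_sum_smul {κ : Type*} [Fintype κ] (r : κ → ℝ) (M : κ → Matrix ι ι ℝ) :
    quadComb z d (Matrix.of fun β γ => ∑ i, r i * M i β γ) =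
      ∑ i, (r i : ℂ) • quadComb z d (M i) := by
  simp only [quadComb, Matrix.of_apply, Complex.ofReal_sum, Complex.ofReal_mul, Finset.sum_smul,
    Finset.smul_sum, smul_smul]
  exact (Finset.sum_congr rfl fun β _ => Finset.sum_comm).trans Finset.sum_comm

lemma linComb_commute {T : Module.End ℂ E} (hd : ∀ α, d α * T = T * d α) (c : ι → ℝ) :
    linComb d c * T = T * linComb d c := by
  simp only [linComb, Finset.sum_mul, Finset.mul_sum, smul_mul_assoc, mul_smul_comm, hd]

lemma quadComb_commute {T : Module.End ℂ E} (hz : ∀ α, z α * T = T * z α)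
    (hd : ∀ α, d α * T = T * d α) (M : Matrix ι ι ℝ) :
    quadComb z d M * T = T * quadComb z d M := by
  simp only [quadComb, Finset.sum_mul, Finset.mul_sum, smul_mul_assoc, mul_smul_comm, mul_assoc,
    hd]
  simp only [← mul_assoc, hz]

variable [DecidableEq ι]

/-- Only the contraction of `d α` with `z β` survives, and it replaces `z β` by `c β`. The
row-vector action `vecMul` matches the convention that `M` is indexed first by `z`, then by `d`. -/
lemma linComb_quadComb_comm (hdd : ∀ α β, d α * d β = d β * d α)
    (hdz : ∀ γ β, d γ * z β = z β * d γ + if γ = β then 1 else 0)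
    (M : Matrix ι ι ℝ) (c : ι → ℝ) :
    linComb d c * quadComb z d M - quadComb z d M * linComb d c =
      linComb d (Matrix.vecMul c M) := by
  have h1 : ∀ α β γ, d α * (z β * d γ) = z β * d γ * d α + if α = β then d γ else 0 :=
    fun α β γ => by
      rw [← mul_assoc, hdz, add_mul, mul_assoc, hdd α γ, mul_assoc, ite_mul, one_mul, zero_mul]
  have h2 : ∀ α, d α * quadComb z d M =
      quadComb z d M * d α + linComb d (M α) := fun α => by
    simp only [quadComb, Finset.mul_sum, Finset.sum_mul, smul_mul_assoc, mul_smul_comm, h1,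
      smul_add, Finset.sum_add_distrib, linComb, smul_ite, smul_zero, Finset.sum_ite_irrel,
      Finset.sum_const_zero, Finset.sum_ite_eq, Finset.mem_univ, if_true]
  have h3 : linComb d c * quadComb z d M =
      quadComb z d M * linComb d c + ∑ α, (c α : ℂ) • linComb d (M α) := by
    have h4 : linComb d c * quadComb z d M = ∑ α, (c α : ℂ) • (d α * quadComb z d M) := by
      simp only [linComb, Finset.sum_mul, smul_mul_assoc]
    rw [h4]
    simp only [h2, smul_add, Finset.sum_add_distrib]
    congr 1
    simp only [linComb, Finset.mul_sum, mul_smul_comm]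
  rw [h3, add_sub_cancel_left]
  simp only [linComb, Finset.smul_sum, smul_smul, Matrix.vecMul, dotProduct, Complex.ofReal_sum,
    Finset.sum_smul, Complex.ofReal_mul]
  exact Finset.sum_comm

/-- Normal ordering writes a product of two quadratic operators as a part with two `z` and two `d`,
plus the quadratic operator of the matrix product. The first part is symmetric in `M` and `N`, so
the commutator sees only the second. -/
lemma quadComb_quadComb_comm (hdd : ∀ α β, d α * d β = d β * d α)
    (hzz : ∀ α β, z α * z β = z β * z α)
    (hdz : ∀ γ β, d γ * z β = z β * d γ + if γ = β then 1 else 0) (M N : Matrix ι ι ℝ) :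
    quadComb z d M * quadComb z d N - quadComb z d N * quadComb z d M =
      quadComb z d (M * N - N * M) := by
  let Q : ι → ι → Matrix ι ι ℝ → Module.End ℂ E := fun β γ N =>
    ∑ β', ∑ γ', (N β' γ' : ℂ) • (z β * z β' * (d γ * d γ'))
  have h1 : ∀ M N : Matrix ι ι ℝ, quadComb z d M * quadComb z d N =
      (∑ β, ∑ γ, (M β γ : ℂ) • Q β γ N) + quadComb z d (M * N) := fun M N => by
    have h2 : ∀ β γ β' γ' : ι, z β * d γ * (z β' * d γ') =
        z β * z β' * (d γ * d γ') + if γ = β' then z β * d γ' else 0 := fun β γ β' γ' => by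
      rw [mul_assoc, ← mul_assoc (d γ), hdz]
      split_ifs <;> simp only [add_mul, mul_add, mul_assoc, one_mul, zero_mul, mul_zero]
    have h3 : ∀ β γ, z β * d γ * quadComb z d N =
        Q β γ N + ∑ γ', (N γ γ' : ℂ) • (z β * d γ') := fun β γ => by
      simp only [quadComb, Finset.mul_sum, mul_smul_comm, h2,
        smul_add, Finset.sum_add_distrib, smul_ite, smul_zero, Finset.sum_ite_irrel,
        Finset.sum_const_zero, Finset.sum_ite_eq, Finset.mem_univ, if_true, Q]
    have h4 : quadComb z d M * quadComb z d N =
        ∑ β, ∑ γ, (M β γ : ℂ) • (z β * d γ * quadComb z d N) := by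
      rw [quadComb.eq_1 z d M]
      simp only [Finset.sum_mul, smul_mul_assoc]
    rw [h4]
    simp only [h3, smul_add, Finset.sum_add_distrib]
    congr 1
    simp only [quadComb, Matrix.mul_apply, Complex.ofReal_sum, Finset.sum_smul, Finset.smul_sum,
      smul_smul, Complex.ofReal_mul]
    exact Finset.sum_congr rfl fun β _ => Finset.sum_comm
  have h5 : ∑ β, ∑ γ, (M β γ : ℂ) • Q β γ N = ∑ β, ∑ γ, (N β γ : ℂ) • Q β γ M := by
    have h6 : ∀ M N : Matrix ι ι ℝ, ∑ β, ∑ γ, (M β γ : ℂ) • Q β γ N =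
        ∑ p : ι × ι, ∑ q : ι × ι, ((M p.1 p.2 : ℂ) * (N q.1 q.2 : ℂ)) •
          (z p.1 * z q.1 * (d p.2 * d q.2)) := fun M N => by
      simp only [Q, Finset.smul_sum, smul_smul, Fintype.sum_prod_type]
    rw [h6, h6, Finset.sum_comm]
    refine Finset.sum_congr rfl fun p _ => Finset.sum_congr rfl fun q _ => ?_
    rw [hdd p.2, hzz p.1, mul_comm]
  rw [h1 M N, h1 N M, quadComb_sub, h5, add_sub_add_left_eq_sub]

end Weyl

/-! ### Fibrewise derivations -/

/-- The operator `c_α ∂/∂z^α`. -/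
def linOp (c : Idx n → ℝ) : Module.End ℂ (WFiber n) := linComb zD c

/-- The operator `M_{βγ} z^β ∂/∂z^γ`. -/
def quadOp (M : Matrix (Idx n) (Idx n) ℝ) : Module.End ℂ (WFiber n) := quadComb zM zD M

lemma linOp_apply (c : Idx n → ℝ) (x : WFiber n) : linOp c x = ∑ α, (c α : ℂ) • zD α x :=
  linComb_apply c x

lemma quadOp_apply (M : Matrix (Idx n) (Idx n) ℝ) (x : WFiber n) :
    quadOp M x = ∑ β, ∑ γ, (M β γ : ℂ) • zM β (zD γ x) :=
  quadComb_apply M x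

lemma linOp_add (c d : Idx n → ℝ) (x : WFiber n) : linOp (c + d) x = linOp c x + linOp d x :=
  congrArg (fun T => T x) (linComb_add c d)

lemma linOp_sub (c d : Idx n → ℝ) (x : WFiber n) : linOp (c - d) x = linOp c x - linOp d x :=
  congrArg (fun T => T x) (linComb_sub c d)

lemma quadOp_sub (M N : Matrix (Idx n) (Idx n) ℝ) (x : WFiber n) :
    quadOp (M - N) x = quadOp M x - quadOp N x :=
  congrArg (fun T => T x) (quadComb_sub M N)

lemma linOp_eps (c : Idx n → ℝ) (A : Idx n) (x : WFiber n) :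
    linOp c (eps A x) = eps A (linOp c x) :=
  congrArg (fun T => T x) (linComb_commute (fun α => formMul_zD_comm _ α) c)

lemma quadOp_eps (M : Matrix (Idx n) (Idx n) ℝ) (A : Idx n) (x : WFiber n) :
    quadOp M (eps A x) = eps A (quadOp M x) :=
  congrArg (fun T => T x)
    (quadComb_commute (fun α => formMul_zM_comm _ α) (fun α => formMul_zD_comm _ α) M)

lemma linOp_quadOp_comm (M : Matrix (Idx n) (Idx n) ℝ) (c : Idx n → ℝ) (x : WFiber n) :
    linOp c (quadOp M x) - quadOp M (linOp c x) = linOp (Matrix.vecMul c M) x :=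
  congrArg (fun T => T x) (linComb_quadComb_comm zD_zD_comm zD_zM M c)

lemma quadOp_quadOp_comm (M N : Matrix (Idx n) (Idx n) ℝ) (x : WFiber n) :
    quadOp M (quadOp N x) - quadOp N (quadOp M x) = quadOp (M * N - N * M) x :=
  congrArg (fun T => T x) (quadComb_quadComb_comm zD_zD_comm zM_zM_comm zD_zM M N)

/-! ### Fibre operators with variable coefficients, applied to sections. -/

section Sections

variable {V : Set (Phase n)} {a : Phase n → WFiber n} {u : Phase n}

lemma IsSmoothSection.linOp (ha : IsSmoothSection V a) {c : Phase n → Idx n → ℝ}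
    (hc : ∀ α, ContDiffOn ℝ ∞ (fun u => c u α) V) :
    IsSmoothSection V fun u => linOp (c u) (a u) := by
  simp only [linOp_apply]
  exact IsSmoothSection.sum fun α => (ha.map (rowFinite_zD α)).smul (hc α)

lemma IsSmoothSection.quadOp (ha : IsSmoothSection V a) {M : Phase n → Matrix (Idx n) (Idx n) ℝ}
    (hM : ∀ α β, ContDiffOn ℝ ∞ (fun u => M u α β) V) :
    IsSmoothSection V fun u => quadOp (M u) (a u) := by
  simp only [quadOp_apply]
  exact IsSmoothSection.sum fun α => IsSmoothSection.sum fun β =>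
    ((ha.map (rowFinite_zD β)).map (rowFinite_zM α)).smul (hM α β)

lemma dirDeriv_linOp (hV : IsOpen V) (ha : IsSmoothSection V a) {c : Phase n → Idx n → ℝ}
    (hc : ∀ α, ContDiffOn ℝ ∞ (fun u => c u α) V) (hu : u ∈ V) (X : Phase n) :
    dirDeriv (fun u => linOp (c u) (a u)) u X =
      linOp (c u) (dirDeriv a u X) + linOp (fun α => fderiv ℝ (fun w => c w α) u X) (a u) := by
  simp only [linOp_apply]
  rw [dirDeriv_sum hV (fun α => (ha.map (rowFinite_zD α)).smul (hc α)) hu,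
    ← Finset.sum_add_distrib]
  refine Finset.sum_congr rfl fun α _ => ?_
  rw [dirDeriv_smul hV (ha.map (rowFinite_zD α)) (differentiableAt_of_contDiffOn hV (hc α) hu) hu,
    dirDeriv_map hV ha (rowFinite_zD α) hu]

lemma dirDeriv_quadOp (hV : IsOpen V) (ha : IsSmoothSection V a)
    {M : Phase n → Matrix (Idx n) (Idx n) ℝ}
    (hM : ∀ α β, ContDiffOn ℝ ∞ (fun u => M u α β) V) (hu : u ∈ V) (X : Phase n) :
    dirDeriv (fun u => quadOp (M u) (a u)) u X = quadOp (M u) (dirDeriv a u X) +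
      quadOp (Matrix.of fun α β => fderiv ℝ (fun w => M w α β) u X) (a u) := by
  have h1 : ∀ α β, IsSmoothSection V fun u => zM α (zD β (a u)) := fun α β =>
    (ha.map (rowFinite_zD β)).map (rowFinite_zM α)
  simp only [quadOp_apply]
  rw [dirDeriv_sum hV (fun α => IsSmoothSection.sum fun β => (h1 α β).smul (hM α β)) hu,
    ← Finset.sum_add_distrib]
  refine Finset.sum_congr rfl fun α _ => ?_
  rw [dirDeriv_sum hV (fun β => (h1 α β).smul (hM α β)) hu, ← Finset.sum_add_distrib]
  refine Finset.sum_congr rfl fun β _ => ?_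
  rw [dirDeriv_smul hV (h1 α β) (differentiableAt_of_contDiffOn hV (hM α β) hu) hu,
    dirDeriv_map hV (ha.map (rowFinite_zD β)) (rowFinite_zM α) hu,
    dirDeriv_map hV ha (rowFinite_zD β) hu]
  rfl

/-! ### The operators in coordinates -/

/-- The exterior covariant derivative with connection 1-forms `M_A du^A`. -/
def covD (M : Idx n → Phase n → Matrix (Idx n) (Idx n) ℝ) (a : Phase n → WFiber n)
    (u : Phase n) : WFiber n :=
  ∑ A, eps A (dirDeriv a u (coordVec A) - quadOp (M A u) (a u))

/-- The operator `δ` of the coframe `c_A du^A`. -/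
def coordDelta (c : Idx n → Phase n → Idx n → ℝ) (a : Phase n → WFiber n) (u : Phase n) :
    WFiber n :=
  ∑ A, eps A (linOp (c A u) (a u))

variable {M : Idx n → Phase n → Matrix (Idx n) (Idx n) ℝ} {c : Idx n → Phase n → Idx n → ℝ}

lemma IsSmoothSection.covD_summand (hV : IsOpen V) (ha : IsSmoothSection V a)
    (hM : ∀ A α β, ContDiffOn ℝ ∞ (fun u => M A u α β) V) (A : Idx n) :
    IsSmoothSection V fun u => FedosovHamilton.dirDeriv a u (coordVec A) -
      FedosovHamilton.quadOp (M A u) (a u) :=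
  (ha.dirDeriv hV (coordVec A)).sub (ha.quadOp (hM A))

lemma IsSmoothSection.covD (hV : IsOpen V) (ha : IsSmoothSection V a)
    (hM : ∀ A α β, ContDiffOn ℝ ∞ (fun u => M A u α β) V) : IsSmoothSection V (covD M a) :=
  IsSmoothSection.sum fun A => (ha.covD_summand hV hM A).map (rowFinite_formMul _)

lemma IsSmoothSection.coordDelta (ha : IsSmoothSection V a)
    (hc : ∀ A α, ContDiffOn ℝ ∞ (fun u => c A u α) V) : IsSmoothSection V (coordDelta c a) :=
  IsSmoothSection.sum fun A => (ha.linOp (hc A)).map (rowFinite_formMul _)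

lemma dirDeriv_sum_eps (hV : IsOpen V) {b : Idx n → Phase n → WFiber n}
    (hb : ∀ A, IsSmoothSection V (b A)) (hu : u ∈ V) (X : Phase n) :
    dirDeriv (fun u => ∑ A, eps A (b A u)) u X = ∑ A, eps A (dirDeriv (b A) u X) := by
  rw [dirDeriv_sum hV (a := fun A u => eps A (b A u))
    (fun A => (hb A).map (rowFinite_formMul _)) hu]
  exact Finset.sum_congr rfl fun A _ => dirDeriv_map hV (hb A) (rowFinite_formMul _) hu X

/-- The cancellation behind `covD_covD`: `x` is the second derivative of the section, and `p`, `r`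
are connection terms acting on its first derivatives. They vanish on antisymmetrization; the
coefficient derivatives `q`, `q'` and products `s`, `s'` remain. -/
lemma sub_sub_sub_aux {E : Type*} [AddCommGroup E] (x p q q' r s s' : E) :
    x - (p + q) - (r - s) - (x - (r + q') - (p - s')) = s - s' - (q - q') := by
  abel

lemma add_sub_add_aux {E : Type*} [AddCommGroup E] (p q q' r s s' t t' : E) :
    p + q - s + (r - t) - (r + q' - s' + (p - t')) = q - q' + (t' - s - (t - s')) := by
  abel

/-- The square of the exterior covariant derivative. -/
lemma covD_covD (hV : IsOpen V) (ha : IsSmoothSection V a)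
    (hM : ∀ A α β, ContDiffOn ℝ ∞ (fun u => M A u α β) V) (hu : u ∈ V) :
    covD M (covD M a) u = (1 / 2 : ℂ) • ∑ A, ∑ B, eps A (eps B (quadOp
      ((M A u * M B u - M B u * M A u) -
        ((Matrix.of fun α β => fderiv ℝ (fun w => M B w α β) u (coordVec A)) -
          Matrix.of fun α β => fderiv ℝ (fun w => M A w α β) u (coordVec B))) (a u))) := by
  have h1 : covD M (covD M a) u = ∑ A, ∑ B, eps A (eps B
      (dirDeriv (fun w => dirDeriv a w (coordVec B)) u (coordVec A)
        - (quadOp (M B u) (dirDeriv a u (coordVec A)) +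
          quadOp (Matrix.of fun α β => fderiv ℝ (fun w => M B w α β) u (coordVec A)) (a u))
        - quadOp (M A u) (dirDeriv a u (coordVec B) - quadOp (M B u) (a u)))) := by
    rw [covD]
    refine Finset.sum_congr rfl fun A _ => ?_
    have : dirDeriv (covD M a) u (coordVec A) = _ :=
      dirDeriv_sum_eps hV (fun A => ha.covD_summand hV hM A) hu (coordVec A)
    rw [this, covD, map_sum, ← Finset.sum_sub_distrib, map_sum]
    refine Finset.sum_congr rfl fun B _ => ?_
    rw [quadOp_eps, ← map_sub, dirDeriv_sub hV (ha.dirDeriv hV _) (ha.quadOp (hM B)) hu,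
      dirDeriv_quadOp hV ha (hM B) hu]
  rw [h1, sum_eps_eps]
  refine congrArg (fun y : WFiber n => (1 / 2 : ℂ) • y) ?_
  refine Finset.sum_congr rfl fun A _ => Finset.sum_congr rfl fun B _ => ?_
  refine congrArg (fun y : WFiber n => eps A (eps B y)) ?_
  -- After Schwarz, both orders of differentiation are literally the same term, as the cancellation
  -- lemma requires.
  rw [dirDeriv_dirDeriv_comm hV ha hu (coordVec B) (coordVec A), quadOp_sub,
    ← quadOp_quadOp_comm, quadOp_sub, map_sub, map_sub]
  exact sub_sub_sub_aux _ _ _ _ _ _ _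

/-- The graded commutator of the exterior covariant derivative and `δ`. -/
lemma covD_coordDelta (hV : IsOpen V) (ha : IsSmoothSection V a)
    (hc : ∀ A α, ContDiffOn ℝ ∞ (fun u => c A u α) V) (hu : u ∈ V) :
    covD M (coordDelta c a) u + coordDelta c (covD M a) u =
      (1 / 2 : ℂ) • ∑ A, ∑ B, eps A (eps B (linOp
        (((fun α => fderiv ℝ (fun w => c B w α) u (coordVec A)) -
          fun α => fderiv ℝ (fun w => c A w α) u (coordVec B)) +
          (Matrix.vecMul (c B u) (M A u) - Matrix.vecMul (c A u) (M B u))) (a u))) := by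
  have h1 : covD M (coordDelta c a) u + coordDelta c (covD M a) u = ∑ A, ∑ B, eps A (eps B
      (linOp (c B u) (dirDeriv a u (coordVec A)) +
        linOp (fun α => fderiv ℝ (fun w => c B w α) u (coordVec A)) (a u)
        - quadOp (M A u) (linOp (c B u) (a u))
        + linOp (c A u) (dirDeriv a u (coordVec B) - quadOp (M B u) (a u)))) := by
    rw [covD, coordDelta.eq_1 c (covD M a), ← Finset.sum_add_distrib]
    refine Finset.sum_congr rfl fun A _ => ?_
    have : dirDeriv (coordDelta c a) u (coordVec A) = _ :=
      dirDeriv_sum_eps hV (fun A => ha.linOp (hc A)) hu (coordVec A)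
    rw [this, covD, coordDelta, map_sum, map_sum, ← Finset.sum_sub_distrib, ← map_add,
      ← Finset.sum_add_distrib, map_sum]
    refine Finset.sum_congr rfl fun B _ => ?_
    -- The fibre operators commute with `eps`, so both compositions carry `eps A` and `eps B` in the
    -- same order. Hence the sum of the compositions, not their difference, removes the first
    -- derivatives of the section.
    rw [quadOp_eps, linOp_eps, ← map_sub, ← map_add, dirDeriv_linOp hV ha (hc B) hu]
  rw [h1, sum_eps_eps]
  refine congrArg (fun y : WFiber n => (1 / 2 : ℂ) • y) ?_
  refine Finset.sum_congr rfl fun A _ => Finset.sum_congr rfl fun B _ => ?_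
  refine congrArg (fun y : WFiber n => eps A (eps B y)) ?_
  rw [linOp_add, linOp_sub, linOp_sub, ← linOp_quadOp_comm, ← linOp_quadOp_comm, map_sub, map_sub]
  exact add_sub_add_aux _ _ _ _ _ _ _ _

end Sections

/-! ### Passing between the adapted frame and coordinates -/

/-- The coordinate differential `du^A`. -/
def coordL : Idx n → Phase n →L[ℝ] ℝ
  | .inl i => (EuclideanSpace.proj i : EuclideanSpace ℝ (Fin n) →L[ℝ] ℝ) ∘L
      ContinuousLinearMap.fst ℝ _ _
  | .inr a => (EuclideanSpace.proj a : EuclideanSpace ℝ (Fin n) →L[ℝ] ℝ) ∘L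
      ContinuousLinearMap.snd ℝ _ _

lemma coordL_coordVec (A B : Idx n) : coordL A (coordVec B) = if A = B then 1 else 0 := by
  rcases A with i | a <;> rcases B with j | b <;> simp [coordL, coordVec]

lemma sum_coordL_coordVec (X : Phase n) : ∑ A, coordL A X • coordVec A = X := by
  rw [Fintype.sum_sum_type]
  refine Prod.ext ?_ ?_ <;> ext j
  · simp [Prod.fst_sum, coordL, coordVec, Pi.single_apply]
  · simp [Prod.snd_sum, coordL, coordVec, Pi.single_apply]

/-- The 1-form with given coordinate components. -/
def formOf (c : Idx n → Phase n → ℝ) (u : Phase n) : Phase n →L[ℝ] ℝ := ∑ A, c A u • coordL A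

lemma formOf_apply (c : Idx n → Phase n → ℝ) (u X : Phase n) :
    formOf c u X = ∑ A, c A u * coordL A X := by
  simp only [formOf, sum_apply, _root_.smul_apply, smul_eq_mul]

lemma formOf_coordVec (c : Idx n → Phase n → ℝ) (u : Phase n) (B : Idx n) :
    formOf c u (coordVec B) = c B u := by
  simp only [formOf_apply, coordL_coordVec, mul_ite, mul_one, mul_zero, Finset.sum_ite_eq',
    Finset.mem_univ, if_true]

lemma differentiableAt_formOf {c : Idx n → Phase n → ℝ} {u : Phase n}
    (hc : ∀ A, DifferentiableAt ℝ (c A) u) : DifferentiableAt ℝ (formOf c) u :=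
  DifferentiableAt.fun_sum fun A _ => (hc A).smul_const _

lemma fderiv_formOf_coordVec {c : Idx n → Phase n → ℝ} {u : Phase n}
    (hc : ∀ A, DifferentiableAt ℝ (c A) u) (X : Phase n) (B : Idx n) :
    fderiv ℝ (formOf c) u X (coordVec B) = fderiv ℝ (c B) u X := by
  have h1 := fderiv_clm_apply (differentiableAt_formOf hc) (differentiableAt_const (coordVec B))
  simp only [formOf_coordVec] at h1
  rw [h1]
  simp

/-- The coframe as a linear form. -/
def coframeLin (h : Phase n → ℝ) (α : Idx n) (u : Phase n) : Phase n →ₗ[ℝ] ℝ where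
  toFun := coframe h α u
  map_add' X Y := by
    rcases α with i | a <;>
      simp only [coframe, vForm, Prod.fst_add, Prod.snd_add, PiLp.add_apply, mul_add,
        Finset.sum_add_distrib, mul_sub, Finset.sum_sub_distrib] <;> ring
  map_smul' r X := by
    have : ∀ b, vForm h b u (r • X) = r * vForm h b u X := fun b => by
      simp only [vForm, Prod.smul_fst, Prod.smul_snd, PiLp.smul_apply, smul_eq_mul, mul_sub,
        Finset.mul_sum, mul_left_comm]
    rcases α with i | a <;>
      simp only [coframe, this, Prod.smul_fst, PiLp.smul_apply, smul_eq_mul, mul_add,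
        Finset.mul_sum, mul_left_comm, RingHom.id_apply]

lemma coframe_eq_sum (h : Phase n → ℝ) (α : Idx n) (u X : Phase n) :
    coframe h α u X = ∑ A, coframe h α u (coordVec A) * coordL A X := by
  change coframeLin h α u X = ∑ A, coframeLin h α u (coordVec A) * coordL A X
  conv_lhs => rw [← sum_coordL_coordVec X]
  simp only [map_sum, map_smul, smul_eq_mul, mul_comm]

/-- A bilinear form is determined by its components in the adapted frame. -/
lemma sum_coframe_coframe (h : Phase n → ℝ) (u X Y : Phase n)
    (B : Phase n →L[ℝ] Phase n →L[ℝ] ℝ) :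
    ∑ α, ∑ β, coframe h α u X * coframe h β u Y * B (frame h α u) (frame h β u) = B X Y := by
  conv_rhs => rw [← sum_coframe_frame h u X, ← sum_coframe_frame h u Y]
  simp only [map_sum, map_smul, sum_apply, _root_.smul_apply, smul_eq_mul,
    Finset.mul_sum, mul_assoc]
  rw [Finset.sum_comm]
  exact Finset.sum_congr rfl fun β _ => Finset.sum_congr rfl fun α _ => mul_left_comm _ _ _

/-- The components of the coframe. -/
def coframeComp (h : Phase n → ℝ) (A : Idx n) (u : Phase n) (α : Idx n) : ℝ :=
  coframe h α u (coordVec A)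

/-- The connection 1-forms in coordinates. -/
def connMat (h : Phase n → ℝ) (A : Idx n) (u : Phase n) : Matrix (Idx n) (Idx n) ℝ :=
  Matrix.of fun β γ => ∑ α, coframe h α u (coordVec A) * gam h α β γ u

/-- Exterior multiplication by the coframe form `e^α`. -/
def coE (h : Phase n → ℝ) (α : Idx n) (u : Phase n) : Module.End ℂ (WFiber n) :=
  LinearMap.mulLeft ℂ (coframeForm h α u)

lemma coE_apply (h : Phase n → ℝ) (α : Idx n) (u : Phase n) (x : WFiber n) :
    coE h α u x = coframeForm h α u * x := rfl

lemma coE_eq_sum (h : Phase n → ℝ) (α : Idx n) (u : Phase n) :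
    coE h α u = ∑ A, (coframe h α u (coordVec A) : ℂ) • eps A := by
  have h1 : (fun β => (coframe h α u (coordVec β) : ℂ)) =
      ∑ A, (coframe h α u (coordVec A) : ℂ) • (Pi.single A 1 : Idx n → ℂ) := by
    ext β
    simp only [Finset.sum_apply, Pi.smul_apply, Pi.single_apply, smul_eq_mul, mul_ite, mul_one,
      mul_zero, Finset.sum_ite_eq, Finset.mem_univ, if_true]
  change formMulHom (ExteriorAlgebra.ι ℂ _) = _
  rw [h1]
  simp only [map_sum, map_smul]
  rfl

lemma sum_coE (h : Phase n → ℝ) (u : Phase n) (F : Idx n → WFiber n) :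
    ∑ α, coE h α u (F α) =
      ∑ A, eps A (∑ α, (coframe h α u (coordVec A) : ℂ) • F α) := by
  simp only [coE_eq_sum, LinearMap.sum_apply, LinearMap.smul_apply, map_sum, map_smul]
  exact Finset.sum_comm

lemma sum_smul_linOp (r : Idx n → Idx n → ℝ) (c : Idx n → Idx n → Idx n → ℝ) (x : WFiber n) :
    ∑ α, ∑ β, (r α β : ℂ) • linOp (c α β) x =
      linOp (fun τ => ∑ α, ∑ β, r α β * c α β τ) x := by
  have h1 := linComb_sum_smul (d := zD (n := n)) (fun p : Idx n × Idx n => r p.1 p.2)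
    fun p => c p.1 p.2
  have h2 := congrArg (fun T => T x) h1
  simp only [LinearMap.sum_apply, LinearMap.smul_apply, Fintype.sum_prod_type] at h2
  exact h2.symm

lemma sum_smul_quadOp (r : Idx n → Idx n → ℝ) (M : Idx n → Idx n → Matrix (Idx n) (Idx n) ℝ)
    (x : WFiber n) : ∑ α, ∑ β, (r α β : ℂ) • quadOp (M α β) x =
      quadOp (Matrix.of fun φ τ => ∑ α, ∑ β, r α β * M α β φ τ) x := by
  have h1 := quadComb_sum_smul (z := zM (n := n)) (d := zD)
    (fun p : Idx n × Idx n => r p.1 p.2) fun p => M p.1 p.2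
  have h2 := congrArg (fun T => T x) h1
  simp only [LinearMap.sum_apply, LinearMap.smul_apply, Fintype.sum_prod_type] at h2
  exact h2.symm

lemma sum_coE_coE (h : Phase n → ℝ) (u : Phase n) (F : Idx n → Idx n → WFiber n) :
    ∑ α, ∑ β, coE h α u (coE h β u (F α β)) =
      ∑ A, ∑ B, eps A (eps B (∑ α, ∑ β,
        ((coframe h α u (coordVec A) * coframe h β u (coordVec B) : ℝ) : ℂ) • F α β)) := by
  have h1 : ∀ α, ∑ β, coE h α u (coE h β u (F α β)) = coE h α u (∑ B, eps B (∑ β,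
      (coframe h β u (coordVec B) : ℂ) • F α β)) := fun α => by
    rw [← map_sum, sum_coE]
  simp only [h1, sum_coE]
  refine Finset.sum_congr rfl fun A _ => ?_
  rw [← map_sum]
  refine congrArg (eps A) ?_
  simp only [map_sum, map_smul, Finset.smul_sum, smul_smul, Complex.ofReal_mul]
  rw [Finset.sum_comm]

lemma dirDeriv_sum_smul_right (a : Phase n → WFiber n) (u : Phase n) (r : Idx n → ℝ)
    (X : Idx n → Phase n) :
    dirDeriv a u (∑ α, r α • X α) = ∑ α, (r α : ℂ) • dirDeriv a u (X α) :=
  coordFun_ext fun r μ S => by simp [coordFun_dirDeriv]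

/-- Contracting coframe with frame does not depend on the frame: `∑ e^α(∂_A) e_α = ∂_A`. In
coordinates the differentials are closed and the frame vectors commute, so squaring the operator
produces no bracket terms. -/
lemma extD_eq_covD (h : Phase n → ℝ) (a : Phase n → WFiber n) :
    extD h a = covD (connMat h) a := by
  ext1 u
  have h1 : extD h a u = ∑ α, coE h α u (dirDeriv a u (frame h α u) -
      quadOp (Matrix.of fun β γ => gam h α β γ u) (a u)) := by
    simp only [quadOp_apply, extD, Matrix.of_apply]
    rfl
  rw [h1, sum_coE, covD]
  refine Finset.sum_congr rfl fun A _ => congrArg (eps A) ?_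
  have h2 : quadOp (connMat h A u) (a u) = ∑ α, (coframe h α u (coordVec A) : ℂ) •
      quadOp (Matrix.of fun β γ => gam h α β γ u) (a u) := by
    have := quadComb_sum_smul (z := zM (n := n)) (d := zD)
      (fun α => coframe h α u (coordVec A)) (fun α => Matrix.of fun β γ => gam h α β γ u)
    refine (congrArg (fun T => T (a u)) this).trans ?_
    simp only [LinearMap.sum_apply, LinearMap.smul_apply]
    rfl
  have h3 : dirDeriv a u (coordVec A) = ∑ α, (coframe h α u (coordVec A) : ℂ) •
      dirDeriv a u (frame h α u) := by
    rw [← dirDeriv_sum_smul_right, sum_coframe_frame]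
  rw [h2, h3, ← Finset.sum_sub_distrib]
  refine Finset.sum_congr rfl fun α _ => ?_
  rw [smul_sub]

lemma delta_eq_coordDelta (h : Phase n → ℝ) (a : Phase n → WFiber n) :
    delta h a = coordDelta (coframeComp h) a := by
  ext1 u
  have h1 : delta h a u = ∑ α, coE h α u (zD α (a u)) := rfl
  rw [h1, sum_coE, coordDelta]
  refine Finset.sum_congr rfl fun A _ => congrArg (eps A) ?_
  rw [linOp_apply]
  rfl

/-! ### Torsion and curvature as the 2-forms of the structure equations in coordinates. -/

section

variable {h : Phase n → ℝ} {V : Set (Phase n)} {u : Phase n} {a : Phase n → WFiber n}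

lemma contDiffOn_connMat (hV : IsOpen V) (hh : ContDiffOn ℝ ∞ h V)
    (hdet : ∀ u ∈ V, (gUp h u).det ≠ 0) (A β γ : Idx n) :
    ContDiffOn ℝ ∞ (fun u => connMat h A u β γ) V := by
  simp only [connMat, Matrix.of_apply]
  exact ContDiffOn.sum fun α _ =>
    (contDiffOn_coframe hV hh hdet (coordVec A) α).mul (contDiffOn_gam hV hh hdet α β γ)

lemma contDiffOn_coframeComp (hV : IsOpen V) (hh : ContDiffOn ℝ ∞ h V)
    (hdet : ∀ u ∈ V, (gUp h u).det ≠ 0) (A α : Idx n) :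
    ContDiffOn ℝ ∞ (fun u => coframeComp h A u α) V :=
  contDiffOn_coframe hV hh hdet _ α

lemma formOf_connMat_frame (α β γ : Idx n) (w : Phase n) :
    formOf (fun A w => connMat h A w β γ) w (frame h α w) = gam h α β γ w := by
  have h1 : ∀ α', coframe h α' w (frame h α w) = _ := fun α' => coframe_eq_sum h α' w _
  simp only [coframe_frame] at h1
  simp only [formOf_apply, connMat, Matrix.of_apply, Finset.sum_mul]
  rw [Finset.sum_comm]
  have h2 : ∀ α', ∑ A, coframe h α' w (coordVec A) * gam h α' β γ w * coordL A (frame h α w) =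
      (if α' = α then 1 else 0) * gam h α' β γ w := fun α' => by
    rw [h1, Finset.sum_mul]
    exact Finset.sum_congr rfl fun A _ => by ring
  simp only [h2, ite_mul, one_mul, zero_mul, Finset.sum_ite_eq', Finset.mem_univ, if_true]

lemma formOf_coframeComp (α : Idx n) (w X : Phase n) :
    formOf (fun A w => coframeComp h A w α) w X = coframe h α w X := by
  rw [formOf_apply, coframe_eq_sum]
  rfl

/-- The components of the torsion in coordinates. -/
lemma sum_coframe_tors (hV : IsOpen V) (hh : ContDiffOn ℝ ∞ h V)
    (hdet : ∀ u ∈ V, (gUp h u).det ≠ 0) (hu : u ∈ V) (τ A B : Idx n) :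
    ∑ α, ∑ β, coframe h α u (coordVec A) * coframe h β u (coordVec B) * tors h τ α β u =
      -(fderiv ℝ (fun w => coframeComp h B w τ) u (coordVec A) -
        fderiv ℝ (fun w => coframeComp h A w τ) u (coordVec B) +
        (Matrix.vecMul (coframeComp h B u) (connMat h A u) τ -
          Matrix.vecMul (coframeComp h A u) (connMat h B u) τ)) := by
  let c : Idx n → Idx n → Phase n → ℝ := fun α A w => coframeComp h A w α
  let p : Idx n → Idx n → Idx n → Phase n → ℝ := fun β γ A w => connMat h A w β γ
  have hc : ∀ α A, DifferentiableAt ℝ (c α A) u := fun α A =>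
    differentiableAt_of_contDiffOn hV (contDiffOn_coframeComp hV hh hdet A α) hu
  have hF α := differentiableAt_of_contDiffOn hV (contDiffOn_frame hV hh hdet α) hu
  -- `K` is minus the left side of the first structure equation as a bilinear form. Once `tors` is
  -- known to be its frame components, coordinate components come from bilinearity alone.
  let K : Phase n →L[ℝ] Phase n →L[ℝ] ℝ :=
    -(fderiv ℝ (formOf (c τ)) u - (fderiv ℝ (formOf (c τ)) u).flip +
      ∑ β, ((formOf (p β τ) u).smulRight (formOf (c β) u) -
        (formOf (c β) u).smulRight (formOf (p β τ) u)))
  have hK : ∀ X Y, K X Y = -(fderiv ℝ (formOf (c τ)) u X Y - fderiv ℝ (formOf (c τ)) u Y X +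
      ∑ β, (formOf (p β τ) u X * formOf (c β) u Y -
        formOf (c β) u X * formOf (p β τ) u Y)) := fun X Y => by
    simp only [K, _root_.neg_apply, _root_.add_apply,
      _root_.sub_apply, sum_apply, ContinuousLinearMap.smulRight_apply,
      ContinuousLinearMap.flip_apply, _root_.smul_apply, smul_eq_mul]
  have h1 : ∀ α β, tors h τ α β u = K (frame h α u) (frame h β u) := fun α β => by
    have h2 := fderiv_form_lieBracket (differentiableAt_formOf (hc τ)) (hF α) (hF β)
    -- The functions `e^τ(e_α)` are constant, so the exterior derivative of `e^τ` on frame vectors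
    -- is just the bracket term.
    have h3 : ∀ α, (fun w => formOf (c τ) w (frame h α w)) =
        fun _ => if τ = α then (1 : ℝ) else 0 := fun α => by
      ext w
      rw [formOf_coframeComp, coframe_frame]
    rw [h3, h3, formOf_coframeComp] at h2
    simp only [fderiv_fun_const, Pi.zero_apply, _root_.zero_apply, sub_zero,
      zero_add] at h2
    rw [hK, tors, anh, h2]
    simp only [p, c, formOf_coframeComp, formOf_connMat_frame, coframe_frame, mul_ite, ite_mul,
      mul_one, one_mul, mul_zero, zero_mul, Finset.sum_sub_distrib, Finset.sum_ite_eq',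
      Finset.mem_univ, if_true]
    ring
  simp only [h1]
  rw [sum_coframe_coframe, hK]
  simp only [fderiv_formOf_coordVec (hc τ), formOf_coordVec]
  simp only [c, p, Matrix.vecMul, dotProduct, Finset.sum_sub_distrib, mul_comm]

/-- The components of the curvature in coordinates. -/
lemma sum_coframe_curv (hV : IsOpen V) (hh : ContDiffOn ℝ ∞ h V)
    (hdet : ∀ u ∈ V, (gUp h u).det ≠ 0) (hu : u ∈ V) (τ φ A B : Idx n) :
    ∑ α, ∑ β, coframe h α u (coordVec A) * coframe h β u (coordVec B) * curv h τ φ α β u =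
      ((connMat h A u * connMat h B u - connMat h B u * connMat h A u) -
        ((Matrix.of fun β γ => fderiv ℝ (fun w => connMat h B w β γ) u (coordVec A)) -
          Matrix.of fun β γ => fderiv ℝ (fun w => connMat h A w β γ) u (coordVec B))) φ τ := by
  let p : Idx n → Idx n → Idx n → Phase n → ℝ := fun β γ A w => connMat h A w β γ
  have hp : ∀ β γ A, DifferentiableAt ℝ (p β γ A) u := fun β γ A =>
    differentiableAt_of_contDiffOn hV (contDiffOn_connMat hV hh hdet A β γ) hu
  have hF α := differentiableAt_of_contDiffOn hV (contDiffOn_frame hV hh hdet α) hu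
  let K : Phase n →L[ℝ] Phase n →L[ℝ] ℝ :=
    (∑ σ, ((formOf (p φ σ) u).smulRight (formOf (p σ τ) u) -
        (formOf (p σ τ) u).smulRight (formOf (p φ σ) u))) -
      (fderiv ℝ (formOf (p φ τ)) u - (fderiv ℝ (formOf (p φ τ)) u).flip)
  have hK : ∀ X Y, K X Y = (∑ σ, (formOf (p φ σ) u X * formOf (p σ τ) u Y -
        formOf (p σ τ) u X * formOf (p φ σ) u Y)) -
      (fderiv ℝ (formOf (p φ τ)) u X Y - fderiv ℝ (formOf (p φ τ)) u Y X) := fun X Y => by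
    simp only [K, _root_.sub_apply, sum_apply, ContinuousLinearMap.smulRight_apply,
      ContinuousLinearMap.flip_apply, _root_.smul_apply, smul_eq_mul]
  -- Here the functions `Γ^τ_φ(e_α)` are not constant. Their frame derivatives and the anholonomy
  -- term of `curv` together form the exterior derivative of the connection form.
  have h1 : ∀ α β, curv h τ φ α β u = K (frame h α u) (frame h β u) := fun α β => by
    have h2 := fderiv_form_lieBracket (differentiableAt_formOf (hp φ τ)) (hF α) (hF β)
    have h3 : ∀ α, (fun w => formOf (p φ τ) w (frame h α w)) = gam h α φ τ := fun α => by
      ext w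
      exact formOf_connMat_frame α φ τ w
    rw [h3, h3, ← sum_anh_smul_frame h u α β, map_sum] at h2
    simp only [map_smul, smul_eq_mul, p, formOf_connMat_frame] at h2
    rw [hK, curv]
    simp only [p, formOf_connMat_frame, eD, Finset.sum_add_distrib, Finset.sum_sub_distrib,
      mul_comm (gam h β φ _ u)]
    linarith
  simp only [h1]
  rw [sum_coframe_coframe, hK]
  simp only [fderiv_formOf_coordVec (hp _ _), formOf_coordVec]
  -- Rows of `connMat` are lower indices, opposite to `gamMat`; hence the matrix entry is taken at
  -- `φ τ`.
  simp only [p, Matrix.sub_apply, Matrix.mul_apply, Matrix.of_apply, Finset.sum_sub_distrib,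
    mul_comm (connMat h A u _ τ)]

/-- The commutator of the covariant derivative with `δ` is given by the torsion. -/
lemma extD_delta (hV : IsOpen V) (hh : ContDiffOn ℝ ∞ h V)
    (hdet : ∀ u ∈ V, (gUp h u).det ≠ 0) (ha : IsSmoothSection V a) (hu : u ∈ V) :
    extD h (delta h a) u + delta h (extD h a) u = -((1 / 2 : ℂ) • ∑ α, ∑ β,
      coE h α u (coE h β u (linOp (fun τ => tors h τ α β u) (a u)))) := by
  rw [extD_eq_covD, extD_eq_covD, delta_eq_coordDelta, delta_eq_coordDelta,
    covD_coordDelta hV ha (contDiffOn_coframeComp hV hh hdet) hu, sum_coE_coE, ← smul_neg]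
  refine congrArg (fun y : WFiber n => (1 / 2 : ℂ) • y) ?_
  simp only [← Finset.sum_neg_distrib, ← map_neg]
  refine Finset.sum_congr rfl fun A _ => Finset.sum_congr rfl fun B _ => ?_
  refine congrArg (fun y : WFiber n => eps A (eps B y)) ?_
  simp only [Finset.sum_neg_distrib]
  rw [sum_smul_linOp]
  refine Eq.trans ?_ (congrArg (fun T => T (a u)) (linComb_neg (d := zD) _))
  refine congrArg (fun c => linOp c (a u)) (funext fun τ => ?_)
  rw [Pi.neg_apply, sum_coframe_tors hV hh hdet hu, neg_neg]
  rfl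

/-- The square of the covariant derivative is given by the curvature. -/
lemma extD_extD (hV : IsOpen V) (hh : ContDiffOn ℝ ∞ h V)
    (hdet : ∀ u ∈ V, (gUp h u).det ≠ 0) (ha : IsSmoothSection V a) (hu : u ∈ V) :
    extD h (extD h a) u = (1 / 2 : ℂ) • ∑ α, ∑ β,
      coE h α u (coE h β u (quadOp (Matrix.of fun φ τ => curv h τ φ α β u) (a u))) := by
  rw [extD_eq_covD, extD_eq_covD, covD_covD hV ha (contDiffOn_connMat hV hh hdet) hu,
    sum_coE_coE]
  refine congrArg (fun y : WFiber n => (1 / 2 : ℂ) • y) ?_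
  refine Finset.sum_congr rfl fun A _ => Finset.sum_congr rfl fun B _ => ?_
  refine congrArg (fun y : WFiber n => eps A (eps B y)) ?_
  rw [sum_smul_quadOp]
  refine congrArg (fun M => quadOp M (a u)) (Matrix.ext fun φ τ => ?_)
  exact (sum_coframe_curv hV hh hdet hu τ φ A B).symm

end

/-! ### Forms of degree two -/

/-- Forms of degree two are central. -/
lemma commute_of_mem_two {x : Form n} (hx : x ∈ ⋀[ℂ]^2 (Idx n → ℂ)) (y : Form n) :
    Commute x y := by
  have hswap : ∀ a b : Idx n → ℂ, ExteriorAlgebra.ι ℂ a * ExteriorAlgebra.ι ℂ b =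
      -(ExteriorAlgebra.ι ℂ b * ExteriorAlgebra.ι ℂ a) := fun a b =>
    eq_neg_of_add_eq_zero_left (ExteriorAlgebra.ι_add_mul_swap a b)
  have h1 : ∀ (a b : Idx n → ℂ) (y : Form n),
      Commute (ExteriorAlgebra.ι ℂ a * ExteriorAlgebra.ι ℂ b) y := fun a b y => by
    induction y using ExteriorAlgebra.induction with
    | algebraMap r => exact (Algebra.commutes r _).symm
    | ι m =>
      change _ * _ * _ = _ * (_ * _)
      -- A vector passes two others, and the two signs cancel.
      rw [mul_assoc, hswap b m, mul_neg, ← mul_assoc, hswap a m, neg_mul, neg_neg, mul_assoc]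
    | mul y z hy hz => exact hy.mul_right hz
    | add y z hy hz => exact hy.add_right hz
  rw [ExteriorAlgebra.exteriorPower, sq] at hx
  induction hx using Submodule.mul_induction_on' with
  | mem_mul_mem a ha b hb =>
    obtain ⟨a, rfl⟩ := ha
    obtain ⟨b, rfl⟩ := hb
    exact h1 a b y
  | add a _ b _ ha hb => exact ha.add_left hb

lemma ι_mul_ι_mem_two (a b : Idx n → ℂ) :
    ExteriorAlgebra.ι ℂ a * ExteriorAlgebra.ι ℂ b ∈ ⋀[ℂ]^2 (Idx n → ℂ) := by
  rw [ExteriorAlgebra.exteriorPower, sq]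
  exact Submodule.mul_mem_mul ⟨a, rfl⟩ ⟨b, rfl⟩

lemma exteriorPower_eq_zero {q : ℕ} (hq : 2 * n < q) {x : Form n}
    (hx : x ∈ ⋀[ℂ]^q (Idx n → ℂ)) : x = 0 := by
  have h1 : Module.finrank ℂ (⋀[ℂ]^q (Idx n → ℂ)) = 0 := by
    rw [exteriorPower.finrank_eq, Module.finrank_fintype_fun_eq_card, Fintype.card_sum,
      Fintype.card_fin, Nat.choose_eq_zero_of_lt (by omega)]
  have := Module.finrank_zero_iff.1 h1
  exact congrArg Subtype.val (Subsingleton.elim (⟨x, hx⟩ : ⋀[ℂ]^q (Idx n → ℂ)) 0)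

/-- The series of form degree two that do not depend on `v`. -/
def twoForms (n : ℕ) : Submodule ℂ (WFiber n) where
  carrier := {F | ∀ r μ, wCoeff r μ F ∈ ⋀[ℂ]^2 (Idx n → ℂ) ∧ (r ≠ 0 → wCoeff r μ F = 0)}
  zero_mem' r μ := ⟨zero_mem _, fun _ => rfl⟩
  add_mem' {F G} hF hG r μ := ⟨add_mem (hF r μ).1 (hG r μ).1, fun hr => by
    rw [wCoeff_add, (hF r μ).2 hr, (hG r μ).2 hr, add_zero]⟩
  smul_mem' c F hF r μ := ⟨Submodule.smul_mem _ c (hF r μ).1, fun hr => by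
    rw [wCoeff_smul, (hF r μ).2 hr, smul_zero]⟩

lemma wCoeff_zero (r : ℕ) (μ : Idx n →₀ ℕ) : wCoeff r μ (0 : WFiber n) = 0 := rfl

lemma zM_mem_twoForms {F : WFiber n} (hF : F ∈ twoForms n) (β : Idx n) :
    zM β F ∈ twoForms n := fun r μ => by
  rw [wCoeff_zM]
  split_ifs
  · exact hF r _
  · exact ⟨zero_mem _, fun _ => rfl⟩

lemma formMul_one_mem_twoForms {η : Form n} (hη : η ∈ ⋀[ℂ]^2 (Idx n → ℂ)) :
    formMul η 1 ∈ twoForms n := fun r μ => by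
  classical
  rw [wCoeff_formMul]
  have h1 : wCoeff r μ (1 : WFiber n) = if r = 0 then if μ = 0 then 1 else 0 else 0 := by
    rw [wCoeff, PowerSeries.coeff_one]
    split_ifs with h1 h2
    · rw [MvPowerSeries.coeff_one, if_pos h2]
    · rw [MvPowerSeries.coeff_one, if_neg h2]
    · rfl
  rw [h1]
  split_ifs
  · simpa using ⟨hη, fun h => absurd ‹r = 0› h⟩
  · simp
  · simp

lemma zD_one (α : Idx n) : zD α (1 : WFiber n) = 0 := by
  classical
  refine wCoeff_ext fun r μ => ?_
  have h1 : wCoeff r (μ + Finsupp.single α 1) (1 : WFiber n) = 0 := by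
    rw [wCoeff, PowerSeries.coeff_one]
    split_ifs
    · rw [MvPowerSeries.coeff_one, if_neg]
      intro h
      have := DFunLike.congr_fun h α
      simp at this
    · rfl
  rw [wCoeff_zD, h1, smul_zero, wCoeff_zero]

/-! ### Form degrees -/

lemma degPart_of_mem_twoForms {F : WFiber n} (hF : F ∈ twoForms n) (p : ℕ) :
    degPart p F = if p = 2 then F else 0 := by
  refine wCoeff_ext fun r μ => ?_
  rw [degPart, wCoeff_mk, GradedRing.proj_apply]
  split_ifs with hp
  · subst hp
    exact DirectSum.decompose_of_mem_same _ (hF r μ).1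
  · exact DirectSum.decompose_of_mem_ne _ (hF r μ).1 (Ne.symm hp)

lemma wCoeff_sum {ι : Type*} (s : Finset ι) (r : ℕ) (μ : Idx n →₀ ℕ) (x : ι → WFiber n) :
    wCoeff r μ (∑ i ∈ s, x i) = ∑ i ∈ s, wCoeff r μ (x i) := by
  simp only [wCoeff, map_sum]

/-- Exterior powers of the `2n`-dimensional space vanish above degree `2n`, so the finite range in
`adWick` omits nothing. -/
lemma sum_degPart (b : WFiber n) : ∑ q ∈ Finset.range (2 * n + 1), degPart q b = b := by
  classical
  refine wCoeff_ext fun r μ => ?_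
  rw [wCoeff_sum]
  simp only [degPart, wCoeff_mk, GradedRing.proj_apply]
  conv_rhs => rw [← DirectSum.sum_support_decompose (fun i : ℕ => ⋀[ℂ]^i (Idx n → ℂ))
    (wCoeff r μ b)]
  symm
  refine Finset.sum_subset (fun q hq => ?_) fun q _ hq => ?_
  · rw [Finset.mem_range]
    by_contra hlt
    refine (DFinsupp.mem_support_iff.1 hq) (Subtype.ext ?_)
    exact exteriorPower_eq_zero (by omega) (SetLike.coe_mem _)
  · rw [DFinsupp.notMem_support_iff.1 hq]
    rfl

/-! ### The Wick product with a quadratic element -/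

lemma zDerivSeries_zero (α : Idx n) : zDerivSeries α (0 : ZSeries n) = 0 := by
  refine MvPowerSeries.ext fun μ => ?_
  change (μ α + 1) • (0 : Form n) = 0
  exact smul_zero _

lemma biDiff_zero_left (Lam : Idx n → Idx n → ℂ) (k : ℕ) (g : ZSeries n) :
    biDiff Lam k 0 g = 0 := by
  induction k generalizing g with
  | zero => exact zero_mul g
  | succ k ih => simp only [biDiff, zDerivSeries_zero, ih, smul_zero, Finset.sum_const_zero]

lemma zDerivSeries_comm (α β : Idx n) (f : ZSeries n) :
    zDerivSeries α (zDerivSeries β f) = zDerivSeries β (zDerivSeries α f) := by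
  have := congrArg (fun T => PowerSeries.coeff 0 (T (PowerSeries.C f))) (zD_zD_comm α β)
  simpa [zD_apply, zDeriv] using this

/-- The coefficients of `f` and of all its derivatives are 2-forms, hence central. Exchanging the
factors costs no sign and only transposes the bivector `Lam`. -/
lemma biDiff_swap (Lam : Idx n → Idx n → ℂ) (k : ℕ) {f : ZSeries n}
    (hf : ∀ μ, MvPowerSeries.coeff μ f ∈ ⋀[ℂ]^2 (Idx n → ℂ)) (g : ZSeries n) :
    biDiff Lam k g f = biDiff (fun α β => Lam β α) k f g := by
  classical
  induction k generalizing f g with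
  | zero =>
    change g * f = f * g
    refine MvPowerSeries.ext fun μ => ?_
    rw [MvPowerSeries.coeff_mul, MvPowerSeries.coeff_mul]
    refine Finset.sum_equiv (Equiv.prodComm _ _) (fun s => ?_)
      fun s _ => ((commute_of_mem_two (hf _) _).eq).symm
    simp [add_comm]
  | succ k ih =>
    simp only [biDiff]
    rw [Finset.sum_comm]
    refine Finset.sum_congr rfl fun β _ => Finset.sum_congr rfl fun α _ => ?_
    rw [ih]
    intro μ
    exact Submodule.smul_of_tower_mem _ _ (hf _)

lemma biDiff_eq_zero (Lam : Idx n → Idx n → ℂ) {f : ZSeries n}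
    (hf : ∀ α β γ, zDerivSeries γ (zDerivSeries β (zDerivSeries α f)) = 0) (k : ℕ)
    (g : ZSeries n) : biDiff Lam (k + 3) f g = 0 := by
  simp only [biDiff, hf, biDiff_zero_left, smul_zero, Finset.sum_const_zero]

/-- Transposing `Λ = θ - i g` flips the sign of `θ`, so in `Λ ⊗ Λ` the terms `θ ⊗ θ` and `g ⊗ g` are
unchanged and the difference is `-2i (θ ⊗ g + g ⊗ θ)`. By `hρ` the second mixed contraction is the
first with `β` and `δ` exchanged, and `hU` says these are opposite. -/
lemma second_order_symm {ι R : Type*} [Fintype ι] [Ring R] [Algebra ℂ R] (θ g : ι → ι → ℝ)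
    (hθ : ∀ α β, θ β α = -θ α β) (hg : ∀ α β, g β α = g α β) (ρ κ : ι → ι → R)
    (hρ : ∀ α β, ρ α β = ρ β α)
    (hU : ∀ β δ, ∑ α, ∑ γ, (θ α β * g γ δ : ℂ) • ρ α γ =
      -∑ α, ∑ γ, (θ α δ * g γ β : ℂ) • ρ α γ) {Lam : ι → ι → ℂ}
    (hLam : ∀ α β, Lam α β = (θ α β : ℂ) - Complex.I * (g α β : ℂ)) :
    ∑ α, ∑ β, Lam α β • ∑ γ, ∑ δ, Lam γ δ • (ρ α γ * κ β δ) =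
      ∑ α, ∑ β, Lam β α • ∑ γ, ∑ δ, Lam δ γ • (ρ α γ * κ β δ) := by
  have h1 : ∀ L : ι → ι → ℂ, ∑ α, ∑ β, L α β • ∑ γ, ∑ δ, L γ δ • (ρ α γ * κ β δ) =
      ∑ β, ∑ δ, (∑ α, ∑ γ, (L α β * L γ δ) • ρ α γ) * κ β δ := fun L => by
    simp only [Finset.smul_sum, smul_smul, Finset.sum_mul, smul_mul_assoc]
    rw [Finset.sum_comm]
    refine Finset.sum_congr rfl fun β _ => ?_
    exact (Finset.sum_congr rfl fun α _ => Finset.sum_comm).trans Finset.sum_comm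
  rw [h1, h1 fun α β => Lam β α, ← sub_eq_zero, ← Finset.sum_sub_distrib]
  have h2 : ∀ β δ, (∑ α, ∑ γ, (Lam α β * Lam γ δ) • ρ α γ) -
      ∑ α, ∑ γ, (Lam β α * Lam δ γ) • ρ α γ = 0 := fun β δ => by
    have h3 : ∑ α, ∑ γ, (θ α δ * g γ β : ℂ) • ρ α γ = ∑ α, ∑ γ, (g α β * θ γ δ : ℂ) • ρ α γ := by
      rw [Finset.sum_comm]
      refine Finset.sum_congr rfl fun α _ => Finset.sum_congr rfl fun γ _ => ?_
      rw [hρ γ α, mul_comm]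
    have h4 : ∀ α γ, (Lam α β * Lam γ δ) • ρ α γ - (Lam β α * Lam δ γ) • ρ α γ =
        (-2 * Complex.I) • ((θ α β * g γ δ : ℂ) • ρ α γ + (g α β * θ γ δ : ℂ) • ρ α γ) :=
      fun α γ => by
        rw [← sub_smul, ← add_smul, smul_smul, hLam, hLam, hLam, hLam, hθ α β, hθ γ δ, hg α β,
          hg γ δ]
        congr 1
        push_cast
        ring
    simp only [← Finset.sum_sub_distrib, h4, ← Finset.smul_sum, Finset.sum_add_distrib]
    rw [hU, h3, neg_add_cancel, smul_zero]
  refine Finset.sum_eq_zero fun β _ => ?_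
  rw [← Finset.sum_sub_distrib]
  refine Finset.sum_eq_zero fun δ _ => ?_
  rw [← sub_mul, h2, zero_mul]

/-- The commutator with an element of degree at most two in `z` whose second order term
vanishes. -/
lemma wick_sub_wick {θ g : Idx n → Idx n → ℝ} (hθ : ∀ α β, θ β α = -θ α β)
    (hg : ∀ α β, g β α = g α β) {Lam : Idx n → Idx n → ℂ}
    (hLam : ∀ α β, Lam α β = (θ α β : ℂ) - Complex.I * (g α β : ℂ)) {F : WFiber n}
    (hF : F ∈ twoForms n) (hF3 : ∀ α β γ, zD γ (zD β (zD α F)) = 0)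
    (hU : ∀ β δ, ∑ α, ∑ γ, (θ α β * g γ δ : ℂ) • zD γ (zD α F) =
      -∑ α, ∑ γ, (θ α δ * g γ β : ℂ) • zD γ (zD α F)) (b : WFiber n) :
    wick Lam F b - wick Lam b F =
      PowerSeries.X * ∑ α, ∑ β, (Complex.I * θ α β) • (zD α F * zD β b) := by
  set f : ZSeries n := PowerSeries.coeff 0 F with hf
  have hFf : ∀ r, r ≠ 0 → PowerSeries.coeff r F = 0 := fun r hr =>
    MvPowerSeries.ext fun μ => (hF r μ).2 hr
  have hD : ∀ α (x : WFiber n) r,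
      PowerSeries.coeff r (zD α x) = zDerivSeries α (PowerSeries.coeff r x) := fun α x r =>
    PowerSeries.coeff_mk r fun r => zDerivSeries α (PowerSeries.coeff r x)
  have hsmul : ∀ (c : ℂ) (x : WFiber n) r,
      PowerSeries.coeff r (c • x) = c • PowerSeries.coeff r x := fun c x r => rfl
  have hmul : ∀ α (x : WFiber n) r,
      PowerSeries.coeff r (zD α F * x) = zDerivSeries α f * PowerSeries.coeff r x :=
    fun α x r => by
      have : zD α F = PowerSeries.C (zDerivSeries α f) := PowerSeries.ext fun r => by
        rw [hD, PowerSeries.coeff_C]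
        split_ifs with hr
        · rw [hr]
        · rw [hFf r hr, zDerivSeries_zero]
      rw [this, PowerSeries.coeff_C_mul]
  have hf3 : ∀ α β γ, zDerivSeries γ (zDerivSeries β (zDerivSeries α f)) = 0 := fun α β γ => by
    rw [hf, ← hD, ← hD, ← hD, hF3, map_zero]
  have hf2 : ∀ μ, MvPowerSeries.coeff μ f ∈ ⋀[ℂ]^2 (Idx n → ℂ) := fun μ => (hF 0 μ).1
  have h1 : ∀ r, PowerSeries.coeff r (wick Lam F b) = ∑ k ∈ Finset.range (r + 1),
      ((Complex.I / 2) ^ k / (k.factorial : ℂ)) •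
        biDiff Lam k f (PowerSeries.coeff (r - k) b) := fun r => by
    rw [wick, PowerSeries.coeff_mk]
    refine Finset.sum_congr rfl fun k _ => ?_
    -- `F` lives in order 0 of `v`, so a single pair of the antidiagonal contributes.
    rw [Finset.sum_eq_single (0, r - k)]
    · rintro ⟨s, t⟩ hs hne
      have : s ≠ 0 := by
        rintro rfl
        simp at hs
        exact hne (by rw [hs])
      rw [hFf s this, biDiff_zero_left, smul_zero]
    · intro h
      simp at h
  have h2 : ∀ r, PowerSeries.coeff r (wick Lam b F) = ∑ k ∈ Finset.range (r + 1),
      ((Complex.I / 2) ^ k / (k.factorial : ℂ)) •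
        biDiff (fun α β => Lam β α) k f (PowerSeries.coeff (r - k) b) := fun r => by
    rw [wick, PowerSeries.coeff_mk]
    refine Finset.sum_congr rfl fun k _ => ?_
    rw [Finset.sum_eq_single (r - k, 0)]
    · rw [biDiff_swap Lam k hf2]
    · rintro ⟨s, t⟩ hs hne
      have : t ≠ 0 := by
        rintro rfl
        simp at hs
        exact hne (by rw [hs])
      rw [hFf t this, biDiff_swap (f := 0) Lam k (fun μ => by rw [map_zero]; exact zero_mem _),
        biDiff_zero_left, smul_zero]
    · intro h
      simp at h
  have hzero : ∀ g, biDiff Lam 0 f g = biDiff (fun α β => Lam β α) 0 f g := fun g => rfl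
  have htwo : ∀ g, biDiff Lam 2 f g = biDiff (fun α β => Lam β α) 2 f g := fun x => by
    refine second_order_symm θ g hθ hg (fun α γ => zDerivSeries γ (zDerivSeries α f))
      (fun β δ => zDerivSeries δ (zDerivSeries β x)) (fun _ _ => zDerivSeries_comm _ _ _)
      (fun β δ => ?_) hLam
    have h3 := congrArg (PowerSeries.coeff 0) (hU β δ)
    simpa only [map_sum, map_neg, hsmul, hD] using h3
  -- The symmetric part `-i g` cancels and the antisymmetric part doubles. The factor `2` then meets
  -- the `i/2` of the exponential and gives the `i θ` of the statement.
  have hone : ∀ x, biDiff Lam 1 f x - biDiff (fun α β => Lam β α) 1 f x =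
      ∑ α, ∑ β, (2 * θ α β : ℂ) • (zDerivSeries α f * zDerivSeries β x) := fun x => by
    simp only [biDiff, ← Finset.sum_sub_distrib, ← sub_smul]
    refine Finset.sum_congr rfl fun α _ => Finset.sum_congr rfl fun β _ => ?_
    refine congrArg (fun c : ℂ => c • (zDerivSeries α f * zDerivSeries β x)) ?_
    rw [hLam, hLam, hθ α β, hg α β]
    push_cast
    ring
  refine PowerSeries.ext fun r => ?_
  rcases r with _ | r
  · rw [map_sub, h1, h2, PowerSeries.coeff_zero_X_mul]
    simp [hzero]
  · rw [map_sub, h1, h2, PowerSeries.coeff_succ_X_mul, ← Finset.sum_sub_distrib,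
      Finset.sum_eq_single 1]
    · rw [← smul_sub, hone]
      simp only [map_sum, hsmul, hmul, hD, Finset.smul_sum, smul_smul]
      refine Finset.sum_congr rfl fun α _ => Finset.sum_congr rfl fun β _ => ?_
      refine congrArg₂ (fun (c : ℂ) (x : ZSeries n) => c • x) ?_ rfl
      norm_num
      ring
    · intro k _ hk
      rw [← smul_sub]
      rcases k with _ | _ | _ | k
      · rw [hzero, sub_self, smul_zero]
      · exact absurd rfl hk
      · rw [htwo, sub_self, smul_zero]
      · rw [biDiff_eq_zero _ hf3, biDiff_eq_zero _ hf3, sub_self, smul_zero]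
    · intro h
      simp at h

/-! ### The graded commutator -/

lemma wick_zero_left (Lam : Idx n → Idx n → ℂ) (b : WFiber n) : wick Lam 0 b = 0 := by
  refine PowerSeries.ext fun r => ?_
  rw [wick, PowerSeries.coeff_mk]
  simp only [map_zero, biDiff_zero_left, smul_zero, Finset.sum_const_zero]

lemma biDiff_zero_right (Lam : Idx n → Idx n → ℂ) (k : ℕ) (g : ZSeries n) :
    biDiff Lam k g 0 = 0 := by
  rw [biDiff_swap (f := 0) Lam k (fun μ => by rw [map_zero]; exact zero_mem _), biDiff_zero_left]

lemma wick_zero_right (Lam : Idx n → Idx n → ℂ) (b : WFiber n) : wick Lam b 0 = 0 := by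
  refine PowerSeries.ext fun r => ?_
  rw [wick, PowerSeries.coeff_mk]
  simp only [map_zero, biDiff_zero_right, smul_zero, Finset.sum_const_zero]

/-- The derivation of the commutator with `F`, divided by `v`. -/
def bracketOp (θ : Idx n → Idx n → ℝ) (F : WFiber n) : WFiber n →ₗ[ℂ] WFiber n :=
  ∑ α, ∑ β, (Complex.I * θ α β) • (LinearMap.mulLeft ℂ (zD α F) ∘ₗ zD β)

lemma bracketOp_apply (θ : Idx n → Idx n → ℝ) (F b : WFiber n) : bracketOp θ F b =
    ∑ α, ∑ β, (Complex.I * θ α β) • (zD α F * zD β b) := by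
  simp only [bracketOp, LinearMap.sum_apply, LinearMap.smul_apply, LinearMap.comp_apply,
    LinearMap.mulLeft_apply]

/-- `F` has even form degree 2, so every sign of the graded commutator is `+1` and the degree
components of `b` reassemble. -/
lemma adWick_eq {θ g : Idx n → Idx n → ℝ} (hθ : ∀ α β, θ β α = -θ α β)
    (hg : ∀ α β, g β α = g α β) {Lam : Idx n → Idx n → ℂ}
    (hLam : ∀ α β, Lam α β = (θ α β : ℂ) - Complex.I * (g α β : ℂ)) {F : WFiber n}
    (hF : F ∈ twoForms n) (hF3 : ∀ α β γ, zD γ (zD β (zD α F)) = 0)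
    (hU : ∀ β δ, ∑ α, ∑ γ, (θ α β * g γ δ : ℂ) • zD γ (zD α F) =
      -∑ α, ∑ γ, (θ α δ * g γ β : ℂ) • zD γ (zD α F)) (b : WFiber n) :
    adWick Lam F b = PowerSeries.X * bracketOp θ F b := by
  have h1 : adWick Lam F b = ∑ p ∈ Finset.range (2 * n + 1),
      if p = 2 then PowerSeries.X * bracketOp θ F b else 0 := by
    refine Finset.sum_congr rfl fun p _ => ?_
    simp only [degPart_of_mem_twoForms hF]
    split_ifs with hp
    · subst hp
      have h2 : ∀ q, (-1 : ℂ) ^ (2 * q) = 1 := fun q => by rw [pow_mul]; norm_num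
      simp only [h2, one_smul, wick_sub_wick hθ hg hLam hF hF3 hU, ← bracketOp_apply]
      rw [← Finset.mul_sum, ← map_sum, sum_degPart]
    · simp only [wick_zero_left, wick_zero_right, smul_zero, sub_zero, Finset.sum_const_zero]
  rw [h1, Finset.sum_ite_eq']
  split_ifs with hn
  · rfl
  -- If degree 2 is outside the range, then `n = 0`; the index type is empty and the bracket is an
  -- empty sum.
  · have : n = 0 := by
      rw [Finset.mem_range] at hn
      omega
    subst this
    simp [bracketOp_apply]

lemma divV_X_mul (b : WFiber n) : divV (PowerSeries.X * b) = b :=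
  PowerSeries.ext fun r => by rw [divV, PowerSeries.coeff_mk, PowerSeries.coeff_succ_X_mul]

/-! ### The torsion and curvature elements -/

lemma formMul_one_mul (η : Form n) (x : WFiber n) : formMul η 1 * x = formMul η x := by
  rw [formMul_apply, formMul_apply, mul_one]

lemma zM_mul (φ : Idx n) (x y : WFiber n) : zM φ x * y = zM φ (x * y) := mul_assoc _ _ _

lemma zD_formMul_one (α : Idx n) (η : Form n) : zD α (formMul η 1) = 0 :=
  (congrArg (fun T => T 1) (formMul_zD_comm η α)).trans (by
    rw [Module.End.mul_apply, zD_one, map_zero])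

lemma zD_zM_apply (α γ : Idx n) (x : WFiber n) :
    zD α (zM γ x) = zM γ (zD α x) + if α = γ then x else 0 := by
  refine (congrArg (fun T => T x) (zD_zM α γ)).trans ?_
  split_ifs <;> rfl

/-- The linear element with coefficients `η_γ`. -/
def linElt (η : Idx n → Form n) : WFiber n := ∑ γ, zM γ (formMul (η γ) 1)

/-- The quadratic element with coefficients `η_{γφ}`. -/
def quadElt (η : Idx n → Idx n → Form n) : WFiber n :=
  ∑ γ, ∑ φ, zM γ (zM φ (formMul (η γ φ) 1))

lemma zD_linElt (η : Idx n → Form n) (α : Idx n) : zD α (linElt η) = formMul (η α) 1 := by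
  simp only [linElt, map_sum, zD_zM_apply, zD_formMul_one, map_zero, zero_add, Finset.sum_ite_eq,
    Finset.mem_univ, if_true]

lemma zD_quadElt {η : Idx n → Idx n → Form n} (hη : ∀ α β, η α β = η β α) (α : Idx n) :
    zD α (quadElt η) = (2 : ℂ) • linElt (η α) := by
  simp only [quadElt, map_sum, zD_zM_apply, zD_formMul_one, map_zero, zero_add,
    Finset.sum_add_distrib, Finset.sum_ite_irrel, Finset.sum_const_zero]
  rw [two_smul]
  refine congrArg₂ (· + ·) ?_ ?_
  · refine Finset.sum_congr rfl fun γ _ => ?_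
    rw [Finset.sum_eq_single α, if_pos rfl, hη]
    · intro φ _ hφ
      rw [if_neg (Ne.symm hφ), map_zero]
    · simp
  · simp only [Finset.sum_ite_eq, Finset.mem_univ, if_true]
    rfl

lemma linElt_mem_twoForms {η : Idx n → Form n} (hη : ∀ γ, η γ ∈ ⋀[ℂ]^2 (Idx n → ℂ)) :
    linElt η ∈ twoForms n :=
  Submodule.sum_mem _ fun γ _ => zM_mem_twoForms (formMul_one_mem_twoForms (hη γ)) γ

lemma quadElt_mem_twoForms {η : Idx n → Idx n → Form n}
    (hη : ∀ γ φ, η γ φ ∈ ⋀[ℂ]^2 (Idx n → ℂ)) : quadElt η ∈ twoForms n :=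
  Submodule.sum_mem _ fun γ _ => Submodule.sum_mem _ fun φ _ =>
    zM_mem_twoForms (zM_mem_twoForms (formMul_one_mem_twoForms (hη γ φ)) φ) γ

/-- The 2-form `t_{αβ} e^α ∧ e^β`. -/
def frameTwoForm (h : Phase n → ℝ) (u : Phase n) (t : Idx n → Idx n → ℝ) : Form n :=
  ∑ α, ∑ β, (t α β : ℂ) •
    (ExteriorAlgebra.ι ℂ (fun A => (coframe h α u (coordVec A) : ℂ)) *
      ExteriorAlgebra.ι ℂ fun A => (coframe h β u (coordVec A) : ℂ))

lemma frameTwoForm_mem (h : Phase n → ℝ) (u : Phase n) (t : Idx n → Idx n → ℝ) :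
    frameTwoForm h u t ∈ ⋀[ℂ]^2 (Idx n → ℂ) :=
  Submodule.sum_mem _ fun _ _ => Submodule.sum_mem _ fun _ _ =>
    Submodule.smul_mem _ _ (ι_mul_ι_mem_two _ _)

lemma frameTwoForm_neg (h : Phase n → ℝ) (u : Phase n) (t : Idx n → Idx n → ℝ) :
    frameTwoForm h u (fun α β => -t α β) = -frameTwoForm h u t := by
  simp only [frameTwoForm, Complex.ofReal_neg, neg_smul, Finset.sum_neg_distrib]

lemma frameTwoForm_sum (h : Phase n → ℝ) (u : Phase n) (r : Idx n → ℝ)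
    (t : Idx n → Idx n → Idx n → ℝ) :
    frameTwoForm h u (fun α β => ∑ τ, r τ * t τ α β) =
      ∑ τ, (r τ : ℂ) • frameTwoForm h u (t τ) := by
  simp only [frameTwoForm, Complex.ofReal_sum, Complex.ofReal_mul, Finset.sum_smul,
    Finset.smul_sum, smul_smul]
  exact (Finset.sum_congr rfl fun β _ => Finset.sum_comm).trans Finset.sum_comm

lemma formMul_frameTwoForm (h : Phase n → ℝ) (u : Phase n) (t : Idx n → Idx n → ℝ)
    (x : WFiber n) : formMul (frameTwoForm h u t) x =
      ∑ α, ∑ β, (t α β : ℂ) • coE h α u (coE h β u x) := by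
  have h1 : formMulHom (frameTwoForm h u t) = ∑ α, ∑ β, (t α β : ℂ) •
      (coE h α u * coE h β u) := by
    simp only [frameTwoForm, map_sum, map_smul]
    refine Finset.sum_congr rfl fun α _ => Finset.sum_congr rfl fun β _ => ?_
    exact congrArg (fun T : Module.End ℂ (WFiber n) => (t α β : ℂ) • T) (formMul_mul _ _).symm
  refine (congrArg (fun T => T x) h1).trans ?_
  simp only [LinearMap.sum_apply, LinearMap.smul_apply, Module.End.mul_apply]

lemma sum_contract {ι E : Type*} [Fintype ι] [DecidableEq ι] [AddCommGroup E] [Module ℂ E]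
    {θ ϑ : ι → ι → ℝ} (hθ : ∀ β τ, ∑ α, θ α β * ϑ α τ = if β = τ then 1 else 0) (Z : ι → E)
    (β : ι) : ∑ α, (θ α β : ℂ) • ∑ τ, (ϑ α τ : ℂ) • Z τ = Z β := by
  simp only [Finset.smul_sum, smul_smul]
  rw [Finset.sum_comm]
  have h2 : ∀ τ, ∑ α, ((θ α β : ℂ) * (ϑ α τ : ℂ)) • Z τ =
      (if β = τ then (1 : ℂ) else 0) • Z τ := fun τ => by
    have := congrArg (fun x : ℝ => (x : ℂ)) (hθ β τ)
    push_cast at this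
    rw [← Finset.sum_smul, this]
    split_ifs <;> simp
  simp only [h2, ite_smul, one_smul, zero_smul, Finset.sum_ite_eq, Finset.mem_univ, if_true]

/-- The upper and lower symplectic components cancel, leaving a trace. The sign is `i · i = -1`: one
factor comes from the `i` of `i/v`, the other from the bracket. -/
lemma sum_contract_smul {ι E : Type*} [Fintype ι] [DecidableEq ι] [AddCommGroup E] [Module ℂ E]
    {θ ϑ : ι → ι → ℝ} (hθ : ∀ β τ, ∑ α, θ α β * ϑ α τ = if β = τ then 1 else 0)
    (Z : ι → ι → E) : Complex.I • ∑ α, ∑ β, (Complex.I * θ α β) • ((1 / 2 : ℂ) •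
      ∑ τ, (ϑ α τ : ℂ) • Z τ β) = -((1 / 2 : ℂ) • ∑ τ, Z τ τ) := by
  have h1 : ∀ α β, (Complex.I * θ α β) • ((1 / 2 : ℂ) • ∑ τ, (ϑ α τ : ℂ) • Z τ β) =
      (Complex.I * (1 / 2)) • ((θ α β : ℂ) • ∑ τ, (ϑ α τ : ℂ) • Z τ β) := fun α β => by
    rw [smul_smul, smul_smul]
    congr 1
    ring
  simp only [h1, ← Finset.smul_sum]
  rw [Finset.sum_comm]
  simp only [sum_contract hθ fun τ => Z τ _]
  rw [smul_smul, ← mul_assoc, Complex.I_mul_I, neg_one_mul, neg_smul]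

/-- The coefficients of the torsion element. -/
def torsCoef (h : Phase n → ℝ) (u : Phase n) (γ : Idx n) : Form n :=
  ∑ τ, (thetaLow h u γ τ : ℂ) • frameTwoForm h u fun α β => tors h τ α β u

/-- The coefficients of the curvature element. -/
def curvCoef (h : Phase n → ℝ) (u : Phase n) (γ φ : Idx n) : Form n :=
  ∑ τ, (thetaLow h u γ τ : ℂ) • frameTwoForm h u fun α β => curv h τ φ α β u

lemma formMul_sum_smul (c : Idx n → ℂ) (η : Idx n → Form n) (x : WFiber n) :
    formMul (∑ τ, c τ • η τ) x = ∑ τ, c τ • formMul (η τ) x := by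
  have h1 : formMulHom (∑ τ, c τ • η τ) = ∑ τ, c τ • formMulHom (η τ) := by
    simp only [map_sum, map_smul]
  refine (congrArg (fun T => T x) h1).trans ?_
  simp only [LinearMap.sum_apply, LinearMap.smul_apply]
  rfl

lemma torsionForm_eq (h : Phase n → ℝ) (u : Phase n) :
    torsionForm h u = (1 / 2 : ℂ) • linElt (torsCoef h u) := by
  simp only [torsionForm, linElt, torsCoef, formMul_sum_smul, formMul_frameTwoForm, map_sum,
    map_smul, Finset.smul_sum, smul_smul]
  refine Finset.sum_congr rfl fun γ _ => Finset.sum_congr rfl fun τ _ =>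
    Finset.sum_congr rfl fun α _ => Finset.sum_congr rfl fun β _ => ?_
  refine congrArg₂ (fun (c : ℂ) (x : WFiber n) => c • x) ?_ ?_
  · push_cast
    ring
  · rw [coE_apply, coE_apply, mul_one, zM_apply]

lemma curvatureForm_eq (h : Phase n → ℝ) (u : Phase n) :
    curvatureForm h u = (1 / 4 : ℂ) • quadElt (curvCoef h u) := by
  simp only [curvatureForm, quadElt, curvCoef, formMul_sum_smul, formMul_frameTwoForm, map_sum,
    map_smul, Finset.smul_sum, smul_smul]
  refine Finset.sum_congr rfl fun γ _ => Finset.sum_congr rfl fun φ _ =>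
    Finset.sum_congr rfl fun τ _ => Finset.sum_congr rfl fun α _ =>
    Finset.sum_congr rfl fun β _ => ?_
  refine congrArg₂ (fun (c : ℂ) (x : WFiber n) => c • x) ?_ ?_
  · push_cast
    ring
  · rw [coE_apply, coE_apply, mul_one, zM_apply, zM_apply, mul_assoc]

/-! ### Commutators with the torsion and curvature elements. -/

section

variable {h : Phase n → ℝ} {V : Set (Phase n)} {u : Phase n}

lemma torsCoef_mem (γ : Idx n) : torsCoef h u γ ∈ ⋀[ℂ]^2 (Idx n → ℂ) :=
  Submodule.sum_mem _ fun _ _ => Submodule.smul_mem _ _ (frameTwoForm_mem _ _ _)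

lemma curvCoef_mem (γ φ : Idx n) : curvCoef h u γ φ ∈ ⋀[ℂ]^2 (Idx n → ℂ) :=
  Submodule.sum_mem _ fun _ _ => Submodule.smul_mem _ _ (frameTwoForm_mem _ _ _)

lemma curvCoef_symm (hV : IsOpen V) (hh : ContDiffOn ℝ ∞ h V) (hu : u ∈ V) (γ φ : Idx n) :
    curvCoef h u γ φ = curvCoef h u φ γ := by
  simp only [curvCoef, ← frameTwoForm_sum, thetaLow_curv_symm hV hh hu _ _ γ φ]

lemma thetaUp_skew (hV : IsOpen V) (hh : ContDiffOn ℝ ∞ h V) (hdet : (gUp h u).det ≠ 0)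
    (hu : u ∈ V) (α β : Idx n) : thetaUp h u β α = -thetaUp h u α β := by
  have h1 : (Matrix.of (thetaUp h u)).transpose = -Matrix.of (thetaUp h u) := by
    rw [thetaUp_eq hV hh hdet hu, Matrix.fromBlocks_transpose, Matrix.fromBlocks_neg]
    simp
  exact congrFun (congrFun h1 α) β

lemma sum_thetaUp_thetaLow (hV : IsOpen V) (hh : ContDiffOn ℝ ∞ h V) (hdet : (gUp h u).det ≠ 0)
    (hu : u ∈ V) (β τ : Idx n) :
    ∑ α, thetaUp h u α β * thetaLow h u α τ = if β = τ then 1 else 0 := by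
  have h1 : (Matrix.of (thetaUp h u)).transpose * Matrix.of (thetaLow h u) = 1 := by
    rw [thetaUp_eq hV hh hdet hu, thetaLow_eq hV hh hu, Matrix.fromBlocks_transpose,
      Matrix.fromBlocks_multiply, ← Matrix.fromBlocks_one]
    simp
  have h2 := congrFun (congrFun h1 β) τ
  rwa [Matrix.mul_apply, Matrix.one_apply] at h2

/-- The torsion element is linear in `z`, so the conditions on its second and third derivatives hold
trivially. -/
lemma adWick_torsionForm (hV : IsOpen V) (hh : ContDiffOn ℝ ∞ h V) (hdet : (gUp h u).det ≠ 0)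
    (hu : u ∈ V) (b : WFiber n) : adWick (lam h u) (torsionForm h u) b =
      PowerSeries.X * bracketOp (thetaUp h u) (torsionForm h u) b := by
  have h2 : ∀ α γ, zD γ (zD α (torsionForm h u)) = 0 := fun α γ => by
    rw [torsionForm_eq, map_smul, map_smul, zD_linElt, zD_formMul_one, smul_zero]
  refine adWick_eq (g := fun α β => metricInv h u α β) (thetaUp_skew hV hh hdet hu)
    (fun α β => metricInv_symm hV hh hdet hu β α) (fun _ _ => rfl) ?_ (fun α β γ => ?_)
    (fun β δ => ?_) b
  · rw [torsionForm_eq]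
    exact Submodule.smul_mem _ _ (linElt_mem_twoForms torsCoef_mem)
  · rw [h2, map_zero]
  · simp only [h2, smul_zero, Finset.sum_const_zero, neg_zero]

lemma zD_zD_curvatureForm (hV : IsOpen V) (hh : ContDiffOn ℝ ∞ h V) (hu : u ∈ V) (α γ : Idx n) :
    zD γ (zD α (curvatureForm h u)) = (1 / 2 : ℂ) • formMul (curvCoef h u α γ) 1 := by
  rw [curvatureForm_eq, map_smul, map_smul, zD_quadElt (curvCoef_symm hV hh hu), map_smul,
    zD_linElt, smul_smul]
  norm_num

/-- The second-order condition is where metric compatibility is used. Contracting the Hessian of the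
curvature element with `θ^{αβ}` undoes the lowering by `θ`, and with `g^{γδ}` it leaves half of
`R^β_γ g^{γδ}`, which is skew in `β`, `δ`. -/
lemma adWick_curvatureForm (hV : IsOpen V) (hh : ContDiffOn ℝ ∞ h V)
    (hdet : ∀ u ∈ V, (gUp h u).det ≠ 0) (hu : u ∈ V) (b : WFiber n) :
    adWick (lam h u) (curvatureForm h u) b =
      PowerSeries.X * bracketOp (thetaUp h u) (curvatureForm h u) b := by
  have h2 := zD_zD_curvatureForm hV hh hu
  refine adWick_eq (g := fun α β => metricInv h u α β) (thetaUp_skew hV hh (hdet u hu) hu)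
    (fun α β => metricInv_symm hV hh (hdet u hu) hu β α) (fun _ _ => rfl) ?_ (fun α β γ => ?_)
    (fun β δ => ?_) b
  · rw [curvatureForm_eq]
    exact Submodule.smul_mem _ _ (quadElt_mem_twoForms curvCoef_mem)
  · rw [h2, map_smul, zD_formMul_one, smul_zero]
  · have h3 : ∀ β δ, ∑ α, ∑ γ, ((thetaUp h u α β : ℂ) * (metricInv h u γ δ : ℂ)) •
        zD γ (zD α (curvatureForm h u)) = (1 / 2 : ℂ) • formMul (frameTwoForm h u fun μ ν =>
          ∑ γ, curv h β γ μ ν u * metricInv h u γ δ) 1 := fun β δ => by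
      have h4 : ∀ γ, ∑ α, ((thetaUp h u α β : ℂ) * (metricInv h u γ δ : ℂ)) •
          ((1 / 2 : ℂ) • ∑ τ, (thetaLow h u α τ : ℂ) •
            formMul (frameTwoForm h u fun μ ν => curv h τ γ μ ν u) (1 : WFiber n)) =
          (1 / 2 : ℂ) • (metricInv h u γ δ : ℂ) •
            formMul (frameTwoForm h u fun μ ν => curv h β γ μ ν u) 1 := fun γ => by
        rw [← sum_contract (sum_thetaUp_thetaLow hV hh (hdet u hu) hu) (fun τ =>
          formMul (frameTwoForm h u fun μ ν => curv h τ γ μ ν u) (1 : WFiber n)) β]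
        rw [smul_smul, Finset.smul_sum]
        refine Finset.sum_congr rfl fun α _ => ?_
        rw [smul_smul, smul_smul]
        refine congrArg (fun c : ℂ => c • _) ?_
        ring
      simp only [h2, curvCoef, formMul_sum_smul]
      rw [Finset.sum_comm, Finset.sum_congr rfl fun γ _ => h4 γ, ← Finset.smul_sum,
        ← formMul_sum_smul, ← frameTwoForm_sum]
      simp only [mul_comm]
    rw [h3, h3]
    simp only [curv_metricInv_skew hV hh hdet hu _ _ β δ, frameTwoForm_neg]
    rw [← smul_neg]
    exact congrArg (fun x : WFiber n => (1 / 2 : ℂ) • x)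
      (congrArg (fun T : Module.End ℂ (WFiber n) => T 1) (map_neg formMulHom _))

lemma bracketOp_torsionForm (hV : IsOpen V) (hh : ContDiffOn ℝ ∞ h V) (hdet : (gUp h u).det ≠ 0)
    (hu : u ∈ V) (b : WFiber n) :
    Complex.I • bracketOp (thetaUp h u) (torsionForm h u) b = -((1 / 2 : ℂ) • ∑ α, ∑ β,
      coE h α u (coE h β u (linOp (fun τ => tors h τ α β u) b))) := by
  have h1 : ∀ α β, zD α (torsionForm h u) * zD β b = (1 / 2 : ℂ) • ∑ τ,
      (thetaLow h u α τ : ℂ) • formMul (frameTwoForm h u fun μ ν => tors h τ μ ν u) (zD β b) :=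
    fun α β => by
      rw [torsionForm_eq, map_smul, zD_linElt, smul_mul_assoc, formMul_one_mul, torsCoef,
        formMul_sum_smul]
  have h2 : ∑ α, ∑ β, coE h α u (coE h β u (linOp (fun τ => tors h τ α β u) b)) =
      ∑ τ, formMul (frameTwoForm h u fun μ ν => tors h τ μ ν u) (zD τ b) := by
    simp only [linOp_apply, formMul_frameTwoForm, map_sum, map_smul]
    exact (Finset.sum_congr rfl fun α _ => Finset.sum_comm).trans Finset.sum_comm
  rw [h2, bracketOp_apply]
  simp only [h1]
  exact sum_contract_smul (sum_thetaUp_thetaLow hV hh hdet hu) fun τ β =>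
    formMul (frameTwoForm h u fun μ ν => tors h τ μ ν u) (zD β b)

lemma linElt_mul (η : Idx n → Form n) (x : WFiber n) :
    linElt η * x = ∑ φ, zM φ (formMul (η φ) x) := by
  simp only [linElt, Finset.sum_mul, zM_mul, formMul_one_mul]

lemma coE_zM (α φ : Idx n) (x : WFiber n) : coE h α u (zM φ x) = zM φ (coE h α u x) :=
  (congrArg (fun T : Module.End ℂ (WFiber n) => T x)
    (formMul_zM_comm (ExteriorAlgebra.ι ℂ fun A => (coframe h α u (coordVec A) : ℂ)) φ)).symm

lemma bracketOp_curvatureForm (hV : IsOpen V) (hh : ContDiffOn ℝ ∞ h V)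
    (hdet : ∀ u ∈ V, (gUp h u).det ≠ 0) (hu : u ∈ V) (b : WFiber n) :
    -(Complex.I • bracketOp (thetaUp h u) (curvatureForm h u) b) = (1 / 2 : ℂ) • ∑ α, ∑ β,
      coE h α u (coE h β u (quadOp (Matrix.of fun φ τ => curv h τ φ α β u) b)) := by
  let Z : Idx n → Idx n → WFiber n := fun τ β =>
    ∑ φ, zM φ (formMul (frameTwoForm h u fun μ ν => curv h τ φ μ ν u) (zD β b))
  -- Symmetry of the lowered curvature doubles the derivative of the quadratic element, turning
  -- `1/4` into the same `1/2` as for torsion.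
  have h1 : ∀ α β, zD α (curvatureForm h u) * zD β b = (1 / 2 : ℂ) • ∑ τ,
      (thetaLow h u α τ : ℂ) • Z τ β := fun α β => by
    rw [curvatureForm_eq, map_smul, zD_quadElt (curvCoef_symm hV hh hu), smul_smul,
      smul_mul_assoc, linElt_mul]
    simp only [curvCoef, formMul_sum_smul, map_sum, map_smul, Z, Finset.smul_sum (s := Finset.univ)
      (r := (thetaLow h u α _ : ℂ))]
    rw [Finset.sum_comm]
    norm_num
  have h2 : ∑ α, ∑ β, coE h α u (coE h β u (quadOp (Matrix.of fun φ τ => curv h τ φ α β u) b)) =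
      ∑ τ, Z τ τ := by
    simp only [Z, quadOp_apply, formMul_frameTwoForm, map_sum, map_smul, coE_zM, Matrix.of_apply]
    have h3 : ∀ X : Idx n → Idx n → Idx n → Idx n → WFiber n,
        ∑ α, ∑ β, ∑ φ, ∑ τ, X α β φ τ = ∑ τ, ∑ φ, ∑ α, ∑ β, X α β φ τ := fun X => by
      have h4 : ∀ Y : Idx n → Idx n → Idx n → WFiber n,
          ∑ α, ∑ β, ∑ φ, Y α β φ = ∑ φ, ∑ α, ∑ β, Y α β φ := fun Y =>
        (Finset.sum_congr rfl fun α _ => Finset.sum_comm).trans Finset.sum_comm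
      exact (h4 fun α β φ => ∑ τ, X α β φ τ).trans
        ((Finset.sum_congr rfl fun φ _ => h4 fun α β τ => X α β φ τ).trans Finset.sum_comm)
    exact h3 _
  rw [h2, bracketOp_apply]
  simp only [h1]
  rw [sum_contract_smul (sum_thetaUp_thetaLow hV hh (hdet u hu) hu) Z, neg_neg]

end

end FedosovHamilton

end

theorem mainTheorem5 (n : ℕ) (M : Type*) [TopologicalSpace M]
    [ChartedSpace (EuclideanSpace ℝ (Fin n)) M] [IsManifold (𝓡 n) ∞ M]
    (S : FedosovHamilton.HamiltonSpace n M)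
    (φ : OpenPartialHomeomorph M (EuclideanSpace ℝ (Fin n)))
    (hφ : φ ∈ IsManifold.maximalAtlas (𝓡 n) ∞ M)
    (h : FedosovHamilton.Phase n → ℝ) (hh : h = FedosovHamilton.inChart S.H φ)
    (V : Set (FedosovHamilton.Phase n)) (hV : IsOpen V)
    (hVφ : V ⊆ FedosovHamilton.chartDomain φ)
    (a : FedosovHamilton.Phase n → FedosovHamilton.WFiber n)
    (ha : FedosovHamilton.IsSmoothSection V a) :
    FedosovHamilton.IsSmoothSection V (FedosovHamilton.delta h a) ∧
    FedosovHamilton.IsSmoothSection V (FedosovHamilton.extD h a) ∧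
    ∀ u ∈ V,
      (PowerSeries.X ∣ FedosovHamilton.adWick (FedosovHamilton.lam h u)
          (FedosovHamilton.torsionForm h u) (a u) ∧
        FedosovHamilton.gradedCommutator 1 1 (FedosovHamilton.extD h) (FedosovHamilton.delta h) a u
          = Complex.I • FedosovHamilton.divV (FedosovHamilton.adWick (FedosovHamilton.lam h u)
              (FedosovHamilton.torsionForm h u) (a u))) ∧
      (PowerSeries.X ∣ FedosovHamilton.adWick (FedosovHamilton.lam h u)
          (FedosovHamilton.curvatureForm h u) (a u) ∧
        FedosovHamilton.extD h (FedosovHamilton.extD h a) u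
          = -(Complex.I • FedosovHamilton.divV (FedosovHamilton.adWick (FedosovHamilton.lam h u)
              (FedosovHamilton.curvatureForm h u) (a u)))) := by
  subst hh
  have hhV : ContDiffOn ℝ ∞ (FedosovHamilton.inChart S.H φ) V := (S.smooth φ hφ).mono hVφ
  have hdet : ∀ u ∈ V, (FedosovHamilton.gUp (FedosovHamilton.inChart S.H φ) u).det ≠ 0 :=
    fun u hu => S.nondegenerate φ hφ u (hVφ hu)
  refine ⟨?_, ?_, fun u hu => ⟨?_, ?_⟩⟩
  · rw [FedosovHamilton.delta_eq_coordDelta]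
    exact ha.coordDelta (FedosovHamilton.contDiffOn_coframeComp hV hhV hdet)
  · rw [FedosovHamilton.extD_eq_covD]
    exact ha.covD hV (FedosovHamilton.contDiffOn_connMat hV hhV hdet)
  · rw [FedosovHamilton.adWick_torsionForm hV hhV (hdet u hu) hu, FedosovHamilton.divV_X_mul,
      FedosovHamilton.bracketOp_torsionForm hV hhV (hdet u hu) hu,
      ← FedosovHamilton.extD_delta hV hhV hdet ha hu, FedosovHamilton.gradedCommutator]
    refine ⟨Dvd.intro _ rfl, ?_⟩
    -- Both operators have form degree 1, so the graded commutator is the sum of the two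
    -- compositions.
    rw [mul_one, pow_one, neg_one_smul, sub_neg_eq_add]
  · rw [FedosovHamilton.adWick_curvatureForm hV hhV hdet hu, FedosovHamilton.divV_X_mul,
      FedosovHamilton.bracketOp_curvatureForm hV hhV hdet hu,
      FedosovHamilton.extD_extD hV hhV hdet ha hu]
    exact ⟨Dvd.intro _ rfl, rfl⟩
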